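/- Let $n\ge 2$, $1<p<\frac{n}{n-1}$, $m>p$ and $\lambda>0$. Consider the energy $$J(v,D)=\int_{D}\big\{F(\nabla v,v,x)+W(v,x)\big\}\,dx,$$ where $F:\mathbb{R}^n\times\mathbb{R}\times\mathbb{R}^n\to\mathbb{R}$ and $W:\mathbb{R}\times\mathbb{R}^n\to\mathbb{R}$ satisfy, for all $\xi,x\in\mathbb{R}^n$ and $\tau\in[-1,1]$: - (A) $\lambda^{-1}|\xi|^{p}\le F(\xi,\tau,x)\le\lambda|\xi|^{p}$; - (B) $\lambda^{-1}(1-\tau^{2})^{m}\le W(\tau,x)\le\lambda(1-\tau^{2})^{m}$; - (C) for each fixed $x$, $\tau\mapsto W(\tau,x)$ is nondecreasing on $[-1,0]$ and nonincreasing on $[0,1]$. (No regularity of $F$ and $W$ is assumed; if the nonnegative integrand is not measurable, the integral is understood as a lower integral.) For an open set $\Omega\subseteq\mathbb{R}^n$ (for example $\Omega=\mathbb{R}^n$), a function $u\in W^{1,p}_{\mathrm{loc}}(\Omega,[-1,1])$ is called a minimizer in $\Omega$ if $J(u,D)\le J(v,D)$ for every bounded open $D$ with $\overline D\subseteq\Omega$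 and every $v\in W^{1,p}_{\mathrm{loc}}(\Omega,[-1,1])$ with $v=u$ a.e. in $\Omega\setminus D$. Write $u(x)=c$ for a point value in the representative-independent sense $\lim_{r\to0^+}\frac{1}{|B_r(x)|}\int_{B_r(x)}u\,dy=c$; for a continuous $u$ this is the usual value. Then for every $h\in(0,1)$ there is a radius $\rho>0$, depending only on $h,n,p,m,\lambda$, such that for all $F,W$ satisfying (A), (B), (C), every open $\Omega\supseteq B_\rho=B_\rho(0)$, and every minimizer $u$ in $\Omega$ with $u(0)=0$, one has $$\max_{B_\rho}u\ \ge\ 1-h,$$ in the sense that $u(x)=c$ for some $x\in B_\rho$ and some $c\ge 1-h$. -/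

import Mathlib

open MeasureTheory Set Filter Topology
open scoped ContDiff

/-- `G` is a weak gradient of `v` in the open set `Ω`, tested against smooth functions with compact
support in `Ω`. (The local integrability of `v` and `G` is part of `MemW1pLoc` below.) -/
def IsWeakGradient {n : ℕ} (Ω : Set (EuclideanSpace ℝ (Fin n)))
    (v : EuclideanSpace ℝ (Fin n) → ℝ)
    (G : EuclideanSpace ℝ (Fin n) → EuclideanSpace ℝ (Fin n)) : Prop :=
  ∀ φ : EuclideanSpace ℝ (Fin n) → ℝ, ContDiff ℝ ∞ φ → HasCompactSupport φ → tsupport φ ⊆ Ω →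
    ∫ x in Ω, v x • gradient φ x = - ∫ x in Ω, φ x • G x

/-- `v` belongs to `W^{1,p}_loc(Ω)`, and `G` is its weak gradient there. -/
structure MemW1pLoc {n : ℕ} (p : ℝ) (Ω : Set (EuclideanSpace ℝ (Fin n)))
    (v : EuclideanSpace ℝ (Fin n) → ℝ)
    (G : EuclideanSpace ℝ (Fin n) → EuclideanSpace ℝ (Fin n)) : Prop where
  memLp : ∀ K : Set (EuclideanSpace ℝ (Fin n)), IsCompact K → K ⊆ Ω →
    MemLp v (ENNReal.ofReal p) (volume.restrict K)
  memLp_gradient : ∀ K : Set (EuclideanSpace ℝ (Fin n)), IsCompact K → K ⊆ Ω →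
    MemLp G (ENNReal.ofReal p) (volume.restrict K)
  isWeakGradient : IsWeakGradient Ω v G

/-- `v` belongs to `W^{1,p}_loc(Ω, [-1,1])`, and `G` is its weak gradient there. -/
def Admissible {n : ℕ} (p : ℝ) (Ω : Set (EuclideanSpace ℝ (Fin n)))
    (v : EuclideanSpace ℝ (Fin n) → ℝ)
    (G : EuclideanSpace ℝ (Fin n) → EuclideanSpace ℝ (Fin n)) : Prop :=
  MemW1pLoc p Ω v G ∧ ∀ᵐ x ∂(volume.restrict Ω), v x ∈ Icc (-1 : ℝ) 1

/-- The Ginzburg-Landau energy `J(v, D) = ∫_D (F(∇v, v, x) + W(v, x)) dx`, where `G = ∇v`.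
The integrand is nonnegative for the `F`, `W`, `v` considered, and the energy may be `∞`. -/
noncomputable def energy {n : ℕ}
    (F : EuclideanSpace ℝ (Fin n) → ℝ → EuclideanSpace ℝ (Fin n) → ℝ)
    (W : ℝ → EuclideanSpace ℝ (Fin n) → ℝ)
    (v : EuclideanSpace ℝ (Fin n) → ℝ)
    (G : EuclideanSpace ℝ (Fin n) → EuclideanSpace ℝ (Fin n))
    (D : Set (EuclideanSpace ℝ (Fin n))) : ENNReal :=
  ∫⁻ x in D, ENNReal.ofReal (F (G x) (v x) x + W (v x) x)

/-- `u` is a minimizer of the energy in the open set `Ω`: it is in `W^{1,p}_loc(Ω, [-1,1])`, and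
`J(u, D) ≤ J(v, D)` for every bounded open `D ⊂⊂ Ω` and every `v` in `W^{1,p}_loc(Ω, [-1,1])`
that agrees with `u` (almost everywhere) in `Ω \ D`. -/
def IsMinimizer {n : ℕ} (p : ℝ)
    (F : EuclideanSpace ℝ (Fin n) → ℝ → EuclideanSpace ℝ (Fin n) → ℝ)
    (W : ℝ → EuclideanSpace ℝ (Fin n) → ℝ)
    (Ω : Set (EuclideanSpace ℝ (Fin n)))
    (u : EuclideanSpace ℝ (Fin n) → ℝ) : Prop :=
  ∃ G : EuclideanSpace ℝ (Fin n) → EuclideanSpace ℝ (Fin n), Admissible p Ω u G ∧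
    ∀ D : Set (EuclideanSpace ℝ (Fin n)), IsOpen D → Bornology.IsBounded D → closure D ⊆ Ω →
      ∀ (v : EuclideanSpace ℝ (Fin n) → ℝ)
        (H : EuclideanSpace ℝ (Fin n) → EuclideanSpace ℝ (Fin n)), Admissible p Ω v H →
        (∀ᵐ x ∂(volume.restrict (Ω \ D)), v x = u x) →
        energy F W u G D ≤ energy F W v H D

/-- Assumption (A): `F` has `p`-growth, for all `τ ∈ [-1,1]`. -/
def AssumptionA {n : ℕ} (p lam : ℝ)
    (F : EuclideanSpace ℝ (Fin n) → ℝ → EuclideanSpace ℝ (Fin n) → ℝ) : Prop :=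
  ∀ (ξ : EuclideanSpace ℝ (Fin n)) (τ : ℝ) (x : EuclideanSpace ℝ (Fin n)), τ ∈ Icc (-1 : ℝ) 1 →
    lam⁻¹ * ‖ξ‖ ^ p ≤ F ξ τ x ∧ F ξ τ x ≤ lam * ‖ξ‖ ^ p

/-- Assumption (B): `W` is comparable with `(1 - τ²)^m` for all `τ ∈ [-1,1]`. -/
def AssumptionB {n : ℕ} (m lam : ℝ) (W : ℝ → EuclideanSpace ℝ (Fin n) → ℝ) : Prop :=
  ∀ (τ : ℝ) (x : EuclideanSpace ℝ (Fin n)), τ ∈ Icc (-1 : ℝ) 1 →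
    lam⁻¹ * (1 - τ ^ 2) ^ m ≤ W τ x ∧ W τ x ≤ lam * (1 - τ ^ 2) ^ m

/-- Assumption (C): `W` is (weakly) increasing in `τ` on `[-1,0]`, (weakly) decreasing on `[0,1]`. -/
def AssumptionC {n : ℕ} (W : ℝ → EuclideanSpace ℝ (Fin n) → ℝ) : Prop :=
  ∀ x : EuclideanSpace ℝ (Fin n),
    MonotoneOn (fun τ => W τ x) (Icc (-1 : ℝ) 0) ∧ AntitoneOn (fun τ => W τ x) (Icc (0 : ℝ) 1)

/-- The pointwise value of a Sobolev function, independent of the choice of a representative: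
`u(x) = c` in the sense that the averages of `u` over the balls `B_r(x)` tend to `c` as `r → 0`.
If `u` has a representative that is continuous at `x`, then `c` is the value of that
representative at `x`. -/
def HasPreciseValue {n : ℕ} (u : EuclideanSpace ℝ (Fin n) → ℝ)
    (x : EuclideanSpace ℝ (Fin n)) (c : ℝ) : Prop :=
  Tendsto (fun r : ℝ => ⨍ y in Metric.ball x r, u y) (𝓝[>] 0) (𝓝 c)

/-!
Suppose that `u ≤ 1 - h` almost everywhere in `B_{3R}`. The competitor `u - η (u - l)₊`, for a
radial cutoff function `η`, costs only `W(l, x)` where `η = 1` and `u > l`. If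
`W(τ, x) ≥ W(l, x) + c` for `σ < τ ≤ 1 - h`, where `σ ≤ 0`, while (C) covers `l < τ ≤ σ`, then
minimality and hole filling give the Caccioppoli inequality

  `∫_{B_s ∩ {u > l}} (|∇u|ᵖ + 1_{u > σ}) ≤ K (t - s)⁻ᵖ |B_t ∩ {u > l}|`.

At `l = -1`, where `W` vanishes, there is such a gap above every `σ > -1`; the density of the set
`{u > σ}` in `B_{2R}` is therefore `O(R⁻¹)`. By (B) there is a gap above `σ = 0`, with a fixed
`c`, for all levels `l` close to `-1`. Bounding `|∇u|` by Young's inequality in terms of the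
Caccioppoli integrand, the Gagliardo-Nirenberg-Sobolev inequality for `η (u - l)₊` in `W^{1,1}`
turns this into a De Giorgi iteration over the levels, which starts as soon as `R` is large and
yields `u ≤ -1 + δ` almost everywhere in `B_R`, which contradicts `u(0) = 0`.
-/

open scoped Gradient Convolution

local notation "𝔼" n:max => EuclideanSpace ℝ (Fin n)

section Gradient

variable {V : Type*} [NormedAddCommGroup V] [InnerProductSpace ℝ V] [CompleteSpace V]
  {f g : V → ℝ} {x : V}

theorem gradient_fun_mul (hf : DifferentiableAt ℝ f x) (hg : DifferentiableAt ℝ g x) :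
    ∇ (fun y => f y * g y) x = f x • ∇ g x + g x • ∇ f x := by
  simp [gradient, fderiv_fun_mul hf hg]

theorem gradient_fun_comp {θ : ℝ → ℝ} (hθ : DifferentiableAt ℝ θ (f x))
    (hf : DifferentiableAt ℝ f x) : ∇ (fun y => θ (f y)) x = deriv θ (f x) • ∇ f x := by
  have h : HasFDerivAt (fun y => θ (f y)) (deriv θ (f x) • fderiv ℝ f x) x :=
    hθ.hasDerivAt.comp_hasFDerivAt x hf.hasFDerivAt
  simp [gradient, h.fderiv]

theorem gradient_fun_comp_const_sub (c : V) (hf : DifferentiableAt ℝ f (c - x)) :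
    ∇ (fun y => f (c - y)) x = -∇ f (c - x) := by
  have h : HasFDerivAt (fun y => f (c - y)) ((fderiv ℝ f (c - x)).comp (-.id ℝ V)) x :=
    hf.hasFDerivAt.comp x ((hasFDerivAt_id x).const_sub c)
  simp [gradient, h.fderiv]

theorem norm_gradient (f : V → ℝ) (x : V) : ‖∇ f x‖ = ‖fderiv ℝ f x‖ := by
  simp [gradient]

theorem continuous_gradient {r : WithTop ℕ∞} (hf : ContDiff ℝ r f) (hr : r ≠ 0) :
    Continuous (∇ f) :=
  (InnerProductSpace.toDual ℝ V).symm.continuous.comp (hf.continuous_fderiv hr)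

theorem gradient_of_notMem_tsupport (hx : x ∉ tsupport f) : ∇ f x = 0 := by
  simp [gradient, fderiv_of_notMem_tsupport (𝕜 := ℝ) hx]

theorem tsupport_gradient_subset (f : V → ℝ) : tsupport (∇ f) ⊆ tsupport f :=
  closure_minimal (fun _ hx => by_contra fun h => hx (gradient_of_notMem_tsupport h))
    (isClosed_tsupport f)

theorem hasCompactSupport_gradient (hf : HasCompactSupport f) : HasCompactSupport (∇ f) :=
  hf.of_isClosed_subset (isClosed_tsupport _) (tsupport_gradient_subset f)

end Gradient

section Integrability

variable {X : Type*} [TopologicalSpace X] [T2Space X] [MeasurableSpace X] [OpensMeasurableSpace X]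
  {μ : Measure X} {F : Type*} [NormedAddCommGroup F] [NormedSpace ℝ F] {Ω : Set X}

theorem integrable_smul_of_tsupport_subset {ψ : X → ℝ} {g : X → F} (hψ : Continuous ψ)
    (hψc : HasCompactSupport ψ) (hψΩ : tsupport ψ ⊆ Ω) (hg : LocallyIntegrableOn g Ω μ) :
    Integrable (fun x => ψ x • g x) μ := by
  rw [← integrableOn_iff_integrable_of_support_subset (s := tsupport ψ)]
  · exact (hg.integrableOn_compact_subset hψΩ hψc).continuousOn_smul hψ.continuousOn hψc
  · exact fun x hx => subset_tsupport ψ (left_ne_zero_of_smul hx)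

theorem integrable_smul_of_tsupport_subset' [SecondCountableTopologyEither X F] {v : X → ℝ}
    {ψ : X → F} (hψ : Continuous ψ) (hψc : HasCompactSupport ψ) (hψΩ : tsupport ψ ⊆ Ω)
    (hv : LocallyIntegrableOn v Ω μ) : Integrable (fun x => v x • ψ x) μ := by
  rw [← integrableOn_iff_integrable_of_support_subset (s := tsupport ψ)]
  · exact (hv.integrableOn_compact_subset hψΩ hψc).smul_continuousOn hψ.continuousOn hψc
  · exact fun x hx => subset_tsupport ψ (right_ne_zero_of_smul hx)

end Integrability

section Pratt

variable {α : Type*} [MeasurableSpace α] {μ : Measure α} {b : ℕ → α → ℝ} {B : α → ℝ}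

theorem tendsto_integral_max_sub_zero (hb : ∀ k, AEStronglyMeasurable (b k) μ)
    (hb0 : ∀ k, ∀ᵐ x ∂μ, 0 ≤ b k x) (hB : Integrable B μ)
    (hlim : ∀ᵐ x ∂μ, Tendsto (fun k => b k x) atTop (𝓝 (B x))) :
    Tendsto (fun k => ∫ x, max (B x - b k x) 0 ∂μ) atTop (𝓝 0) := by
  suffices Tendsto (fun k => ∫ x, max (B x - b k x) 0 ∂μ) atTop (𝓝 (∫ _, (0 : ℝ) ∂μ)) by
    simpa only [integral_zero] using this
  refine tendsto_integral_of_dominated_convergence (fun x => |B x|)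
    (fun k => (hB.aestronglyMeasurable.sub (hb k)).sup aestronglyMeasurable_const) hB.abs
    (fun k => ?_) ?_
  · filter_upwards [hb0 k] with x hx
    rw [Real.norm_of_nonneg (le_max_right _ _)]
    exact max_le (by linarith [le_abs_self (B x)]) (abs_nonneg _)
  · filter_upwards [hlim] with x hx
    simpa using (hx.const_sub (B x)).max (tendsto_const_nhds (x := (0 : ℝ)))

/-- Pratt's theorem. -/
theorem tendsto_integral_of_tendsto_bound {F : Type*} [NormedAddCommGroup F] [NormedSpace ℝ F]
    {f : ℕ → α → F} {g : α → F} (hf : ∀ k, AEStronglyMeasurable (f k) μ)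
    (hb : ∀ k, Integrable (b k) μ) (hB : Integrable B μ) (hfb : ∀ k, ∀ᵐ x ∂μ, ‖f k x‖ ≤ b k x)
    (hbB : ∀ k, ∫ x, b k x ∂μ ≤ ∫ x, B x ∂μ)
    (hflim : ∀ᵐ x ∂μ, Tendsto (fun k => f k x) atTop (𝓝 (g x)))
    (hblim : ∀ᵐ x ∂μ, Tendsto (fun k => b k x) atTop (𝓝 (B x))) :
    Tendsto (fun k => ∫ x, f k x ∂μ) atTop (𝓝 (∫ x, g x ∂μ)) := by
  have hgm : AEStronglyMeasurable g μ := aestronglyMeasurable_of_tendsto_ae atTop hf hflim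
  have hgB : ∀ᵐ x ∂μ, ‖g x‖ ≤ B x := by
    filter_upwards [hflim, hblim, ae_all_iff.mpr hfb] with x hfx hbx hx
    exact le_of_tendsto_of_tendsto' hfx.norm hbx hx
  have hfi : ∀ k, Integrable (f k) μ := fun k => (hb k).mono' (hf k) (hfb k)
  have hgi : Integrable g μ := hB.mono' hgm hgB
  have hdi : ∀ k, Integrable (fun x => ‖f k x - g x‖) μ := fun k => ((hfi k).sub hgi).norm
  let e : ℕ → α → ℝ := fun k x => min ‖f k x - g x‖ (2 * B x)
  have hei : ∀ k, Integrable (e k) μ := fun k => (hdi k).inf (hB.const_mul 2)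
  have hmi : ∀ k, Integrable (fun x => max (B x - b k x) 0) μ := fun k =>
    (hB.sub (hb k)).pos_part
  have he : Tendsto (fun k => ∫ x, e k x ∂μ) atTop (𝓝 (∫ _, (0 : ℝ) ∂μ)) := by
    refine tendsto_integral_of_dominated_convergence (fun x => 2 * B x)
      (fun k => (hei k).aestronglyMeasurable) (hB.const_mul 2) (fun k => ?_) ?_
    · filter_upwards [hgB] with x hg
      rw [Real.norm_of_nonneg (le_min (norm_nonneg _) (by linarith [norm_nonneg (g x)]))]
      exact min_le_right _ _
    · filter_upwards [hflim, hgB] with x hfx hg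
      have hB0 : 0 ≤ 2 * B x := by linarith [norm_nonneg (g x)]
      simpa [hB0] using (hfx.sub_const (g x)).norm.min (tendsto_const_nhds (x := 2 * B x))
  -- `‖f k - g‖ ≤ b k + B = 2 * B + (b k - B)`, and `∫ (b k - B) ≤ 0`.
  have hle : ∀ k, ∫ x, ‖f k x - g x‖ ∂μ ≤ ∫ x, e k x ∂μ + ∫ x, max (B x - b k x) 0 ∂μ := by
    intro k
    have hemi : Integrable (fun x => e k x + max (B x - b k x) 0) μ := (hei k).add (hmi k)
    have hbBi : Integrable (fun x => b k x - B x) μ := (hb k).sub hB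
    have hsum : ∫ x, ‖f k x - g x‖ ∂μ
        ≤ ∫ x, (e k x + max (B x - b k x) 0 + (b k x - B x)) ∂μ := by
      refine integral_mono_ae (hdi k) (hemi.add hbBi) ?_
      filter_upwards [hgB, hfb k] with x hg hf
      have := norm_sub_le (f k x) (g x)
      rcases min_cases ‖f k x - g x‖ (2 * B x) with h | h <;>
        rcases max_cases (B x - b k x) 0 with h' | h' <;> simp only [e] <;> linarith
    rw [integral_add hemi hbBi, integral_add (hei k) (hmi k), integral_sub (hb k) hB] at hsum
    linarith [hbB k]
  rw [tendsto_iff_norm_sub_tendsto_zero]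
  refine squeeze_zero (fun _ => norm_nonneg _) (fun k => ?_) <| by
    simpa using he.add (tendsto_integral_max_sub_zero (fun k => (hb k).aestronglyMeasurable)
      (fun k => (hfb k).mono fun x hx => (norm_nonneg _).trans hx) hB hblim)
  rw [← integral_sub (hfi k) hgi]
  exact (norm_integral_le_integral_norm _).trans (hle k)

/-- Almost everywhere convergence of integrable functions whose `L¹` norms do not exceed that of
the integrable limit: the convergence of the bounds in Pratt's theorem. -/
structure PrattConvergence {E : Type*} [NormedAddCommGroup E] (μ : Measure α) (u : ℕ → α → E)
    (w : α → E) : Prop where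
  integrable : ∀ k, Integrable (u k) μ
  integrable_limit : Integrable w μ
  integral_norm_le : ∀ k, ∫ x, ‖u k x‖ ∂μ ≤ ∫ x, ‖w x‖ ∂μ
  tendsto : ∀ᵐ x ∂μ, Tendsto (fun k => u k x) atTop (𝓝 (w x))

theorem PrattConvergence.const {E : Type*} [NormedAddCommGroup E] {w : α → E}
    (hw : Integrable w μ) : PrattConvergence μ (fun _ => w) w :=
  ⟨fun _ => hw, hw, fun _ => le_rfl, .of_forall fun _ => tendsto_const_nhds⟩

theorem PrattConvergence.tendsto_integral {E F : Type*} [NormedAddCommGroup E]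
    [NormedAddCommGroup F] [NormedSpace ℝ F] {u : ℕ → α → E} {w : α → E} {f : ℕ → α → F}
    {g : α → F} {a : α → ℝ} {c : ℝ} (hu : PrattConvergence μ u w) (ha : Integrable a μ)
    (hc : 0 ≤ c) (hf : ∀ k, AEStronglyMeasurable (f k) μ)
    (hfu : ∀ k x, ‖f k x‖ ≤ a x + c * ‖u k x‖)
    (hlim : ∀ᵐ x ∂μ, Tendsto (fun k => f k x) atTop (𝓝 (g x))) :
    Tendsto (fun k => ∫ x, f k x ∂μ) atTop (𝓝 (∫ x, g x ∂μ)) := by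
  have hi : ∀ k, Integrable (fun x => c * ‖u k x‖) μ := fun k => (hu.integrable k).norm.const_mul c
  have hi' : Integrable (fun x => c * ‖w x‖) μ := hu.integrable_limit.norm.const_mul c
  refine tendsto_integral_of_tendsto_bound hf (fun k => ha.add (hi k)) (ha.add hi')
    (fun k => .of_forall (hfu k)) (fun k => ?_) hlim ?_
  · simp only [Pi.add_apply, integral_add ha (hi k), integral_add ha hi', integral_const_mul]
    exact add_le_add le_rfl (mul_le_mul_of_nonneg_left (hu.integral_norm_le k) hc)
  · filter_upwards [hu.tendsto] with x hx
    exact (hx.norm.const_mul c).const_add (a x)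

end Pratt

theorem integral_norm_convolution_le {V F : Type*} [AddCommGroup V] [MeasurableSpace V]
    [MeasurableAdd₂ V] [MeasurableNeg V] {μ : Measure V} [SFinite μ] [μ.IsAddRightInvariant]
    [NormedAddCommGroup F] [NormedSpace ℝ F] {f : V → ℝ} {g : V → F} (hf : Integrable f μ)
    (hg : Integrable g μ) :
    ∫ x, ‖(f ⋆[.lsmul ℝ ℝ, μ] g) x‖ ∂μ ≤ (∫ x, ‖f x‖ ∂μ) * ∫ x, ‖g x‖ ∂μ := by
  have h : ∫ x, ((fun y => ‖f y‖) ⋆[.lsmul ℝ ℝ, μ] fun y => ‖g y‖) x ∂μ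
      = (∫ x, ‖f x‖ ∂μ) * ∫ x, ‖g x‖ ∂μ := by
    simpa using integral_convolution (.lsmul ℝ ℝ) hf.norm hg.norm
  rw [← h]
  refine integral_mono_of_nonneg (.of_forall fun _ => norm_nonneg _)
    (hf.norm.integrable_convolution _ hg.norm) (.of_forall fun x => ?_)
  refine (norm_integral_le_integral_norm _).trans_eq ?_
  simp [convolution, norm_smul]

section WeakGradient

variable {n : ℕ} {Ω : Set (𝔼 n)} {v w : 𝔼 n → ℝ} {G H : 𝔼 n → 𝔼 n}

theorem isWeakGradient_iff : IsWeakGradient Ω v G ↔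
    ∀ φ : 𝔼 n → ℝ, ContDiff ℝ ∞ φ → HasCompactSupport φ → tsupport φ ⊆ Ω →
      ∫ x, v x • ∇ φ x = -∫ x, φ x • G x := by
  refine forall₄_congr fun φ _ _ hφΩ => ?_
  have hφ : ∀ x ∉ Ω, x ∉ tsupport φ := fun x hx hxφ => hx (hφΩ hxφ)
  rw [setIntegral_eq_integral_of_forall_compl_eq_zero fun x hx => by
      rw [gradient_of_notMem_tsupport (hφ x hx), smul_zero],
    setIntegral_eq_integral_of_forall_compl_eq_zero fun x hx => by
      rw [image_eq_zero_of_notMem_tsupport (hφ x hx), zero_smul]]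

theorem IsWeakGradient.sub (hv : LocallyIntegrableOn v Ω) (hG : LocallyIntegrableOn G Ω)
    (hw : LocallyIntegrableOn w Ω) (hH : LocallyIntegrableOn H Ω) (hvG : IsWeakGradient Ω v G)
    (hwH : IsWeakGradient Ω w H) :
    IsWeakGradient Ω (fun x => v x - w x) (fun x => G x - H x) := by
  rw [isWeakGradient_iff] at hvG hwH ⊢
  intro φ hφ hφc hφΩ
  have hφ' := continuous_gradient hφ (by simp)
  have hφc' := hasCompactSupport_gradient hφc
  have hφΩ' := (tsupport_gradient_subset φ).trans hφΩ
  simp only [sub_smul, smul_sub]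
  rw [integral_sub (integrable_smul_of_tsupport_subset' hφ' hφc' hφΩ' hv)
      (integrable_smul_of_tsupport_subset' hφ' hφc' hφΩ' hw),
    integral_sub (integrable_smul_of_tsupport_subset hφ.continuous hφc hφΩ hG)
      (integrable_smul_of_tsupport_subset hφ.continuous hφc hφΩ hH),
    hvG φ hφ hφc hφΩ, hwH φ hφ hφc hφΩ]
  abel

theorem isWeakGradient_gradient (hv : ContDiff ℝ 1 v) : IsWeakGradient univ v (∇ v) := by
  rw [isWeakGradient_iff]
  intro φ hφ hφc _
  have hv' := continuous_gradient hv one_ne_zero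
  have hφ' := continuous_gradient hφ (by simp)
  have i₁ : Integrable fun x => v x • ∇ φ x :=
    (hv.continuous.smul hφ').integrable_of_hasCompactSupport
      (hasCompactSupport_gradient hφc).smul_left
  have i₂ : Integrable fun x => φ x • ∇ v x :=
    (hφ.continuous.smul hv').integrable_of_hasCompactSupport hφc.smul_right
  have i₃ : Integrable fun x => v x * φ x :=
    (hv.continuous.mul hφ.continuous).integrable_of_hasCompactSupport hφc.mul_left
  refine ext_inner_left ℝ fun e => ?_
  have j₁ := i₁.const_inner (𝕜 := ℝ) e
  have j₂ := i₂.const_inner (𝕜 := ℝ) e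
  rw [inner_neg_right, ← integral_inner i₁, ← integral_inner i₂]
  simp only [inner_smul_right, inner_gradient_right, conj_trivial] at j₁ j₂ ⊢
  rw [integral_mul_fderiv_eq_neg_fderiv_mul_of_integrable (by simpa only [mul_comm] using j₂) j₁ i₃
    (fun x _ => hv.differentiable one_ne_zero x) (fun x _ => hφ.differentiable (by simp) x)]
  simp only [mul_comm]

theorem gradient_convolution {ψ : 𝔼 n → ℝ} (hψ : ContDiff ℝ ∞ ψ) (hψc : HasCompactSupport ψ)
    (hv : LocallyIntegrable v) (hvG : IsWeakGradient univ v G) :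
    ∇ (ψ ⋆[.lsmul ℝ ℝ, volume] v) = ψ ⋆[.lsmul ℝ ℝ, volume] G := by
  ext1 x
  have hψ' := continuous_gradient hψ (by simp)
  have htest := isWeakGradient_iff.mp hvG (fun y => ψ (x - y))
    (hψ.comp (contDiff_const.sub contDiff_id))
    (hψc.comp_homeomorph (Homeomorph.subLeft x)) (subset_univ _)
  simp only [gradient_fun_comp_const_sub x (hψ.differentiable (by simp) _), smul_neg,
    integral_neg, neg_inj] at htest
  have hi : Integrable fun y => v y • ∇ ψ (x - y) :=
    hv.integrable_smul_right_of_hasCompactSupport (hψ'.comp (continuous_const.sub continuous_id))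
      ((hasCompactSupport_gradient hψc).comp_homeomorph (Homeomorph.subLeft x))
  have hd := hψc.hasFDerivAt_convolution_left (.lsmul ℝ ℝ) (hψ.of_le (by simp)) hv x
  have hex := (hψc.fderiv ℝ).convolutionExists_left
    (ContinuousLinearMap.precompL (𝔼 n) (.lsmul ℝ ℝ)) (hψ.continuous_fderiv (by simp)) hv x
  rw [convolution_eq_swap (g := G)]
  simp only [ContinuousLinearMap.lsmul_apply]
  rw [← htest]
  refine ext_inner_left ℝ fun e => ?_
  rw [← integral_inner hi, inner_gradient_right, hd.fderiv, conj_trivial, convolution_eq_swap,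
    ContinuousLinearMap.integral_apply hex.integrable_swap]
  refine integral_congr_ae (.of_forall fun y => ?_)
  simp [inner_smul_right, inner_gradient_right, mul_comm]

/-- Smooth functions `F k` that approximate an integrable function `v` with weak gradient `G` the
way its mollifications do: pointwise, and without increasing the `L¹` norms. -/
structure IsSmoothApprox (v : 𝔼 n → ℝ) (G : 𝔼 n → 𝔼 n) (F : ℕ → 𝔼 n → ℝ) : Prop where
  contDiff : ∀ k, ContDiff ℝ ∞ (F k)
  hasCompactSupport : HasCompactSupport v → ∀ k, HasCompactSupport (F k)
  prattConvergence : PrattConvergence volume F v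
  prattConvergence_gradient : PrattConvergence volume (fun k => ∇ (F k)) G

/-- A sequence of bumps at the origin with radii tending to zero, the kernels of the
mollification. -/
noncomputable def shrinkingBump (n k : ℕ) : ContDiffBump (0 : 𝔼 n) where
  rIn := 1 / ((k : ℝ) + 1)
  rOut := 2 * (1 / ((k : ℝ) + 1))
  rIn_pos := by positivity
  rIn_lt_rOut := by linarith [show (0 : ℝ) < 1 / ((k : ℝ) + 1) by positivity]

theorem prattConvergence_shrinkingBump_convolution {F : Type*} [NormedAddCommGroup F]
    [NormedSpace ℝ F] [CompleteSpace F] {g : 𝔼 n → F} (hg : Integrable g) :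
    PrattConvergence volume
      (fun k => (shrinkingBump n k).normed volume ⋆[.lsmul ℝ ℝ, volume] g) g where
  integrable k := (shrinkingBump n k).integrable_normed.integrable_convolution _ hg
  integrable_limit := hg
  integral_norm_le k := by
    refine (integral_norm_convolution_le (shrinkingBump n k).integrable_normed hg).trans_eq ?_
    simp only [Real.norm_of_nonneg ((shrinkingBump n k).nonneg_normed _),
      (shrinkingBump n k).integral_normed, one_mul]
  tendsto := ContDiffBump.ae_convolution_tendsto_right_of_locallyIntegrable (K := 2)
    (by simpa [shrinkingBump] using tendsto_one_div_add_atTop_nhds_zero_nat.const_mul (2 : ℝ))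
    (.of_forall fun _ => le_rfl) hg.locallyIntegrable

theorem IsWeakGradient.exists_isSmoothApprox (hvG : IsWeakGradient univ v G) (hv : Integrable v)
    (hG : Integrable G) : ∃ F, IsSmoothApprox v G F := by
  let φ := shrinkingBump n
  refine ⟨fun k => (φ k).normed volume ⋆[.lsmul ℝ ℝ, volume] v, fun k => ?_, fun hc k => ?_,
    prattConvergence_shrinkingBump_convolution hv, ?_⟩
  · exact (φ k).hasCompactSupport_normed.contDiff_convolution_left _ (φ k).contDiff_normed
      hv.locallyIntegrable
  · exact (φ k).hasCompactSupport_normed.convolution _ hc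
  · simpa only [gradient_convolution (φ _).contDiff_normed (φ _).hasCompactSupport_normed
      hv.locallyIntegrable hvG] using prattConvergence_shrinkingBump_convolution hG

end WeakGradient

section ChainRule

variable {n : ℕ} {v : 𝔼 n → ℝ} {G : 𝔼 n → 𝔼 n}

theorem isWeakGradient_of_prattConvergence {u w : ℕ → 𝔼 n → ℝ} {U H : ℕ → 𝔼 n → 𝔼 n}
    {u' : 𝔼 n → ℝ} {U' : 𝔼 n → 𝔼 n} {a c : ℝ} (hu : PrattConvergence volume u u')
    (hU : PrattConvergence volume U U') (hc : 0 ≤ c) (hw : ∀ k, AEStronglyMeasurable (w k))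
    (hH : ∀ k, AEStronglyMeasurable (H k)) (hwu : ∀ k x, ‖w k x‖ ≤ a + c * ‖u k x‖)
    (hHU : ∀ k x, ‖H k x‖ ≤ c * ‖U k x‖)
    (hwv : ∀ᵐ x, Tendsto (fun k => w k x) atTop (𝓝 (v x)))
    (hHG : ∀ᵐ x, Tendsto (fun k => H k x) atTop (𝓝 (G x)))
    (h : ∀ k, IsWeakGradient univ (w k) (H k)) : IsWeakGradient univ v G := by
  simp only [isWeakGradient_iff] at h ⊢
  intro φ hφ hφc hφΩ
  have hφ' := continuous_gradient hφ (by simp)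
  have hφc' := hasCompactSupport_gradient hφc
  obtain ⟨M, hM⟩ := hφ.continuous.bounded_above_of_compact_support hφc
  obtain ⟨C, hC⟩ := hφ'.bounded_above_of_compact_support hφc'
  have hM0 : 0 ≤ M := (norm_nonneg _).trans (hM 0)
  have hC0 : 0 ≤ C := (norm_nonneg _).trans (hC 0)
  have hleft : Tendsto (fun k => ∫ x, w k x • ∇ φ x) atTop (𝓝 (∫ x, v x • ∇ φ x)) := by
    refine hu.tendsto_integral
      ((hφ'.integrable_of_hasCompactSupport hφc').norm.const_mul a) (mul_nonneg hc hC0)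
      (fun k => (hw k).smul hφ'.aestronglyMeasurable) (fun k x => ?_)
      (hwv.mono fun x hx => hx.smul_const _)
    rw [norm_smul]
    calc ‖w k x‖ * ‖∇ φ x‖ ≤ (a + c * ‖u k x‖) * ‖∇ φ x‖ := by gcongr; exact hwu k x
      _ = a * ‖∇ φ x‖ + c * ‖∇ φ x‖ * ‖u k x‖ := by ring
      _ ≤ a * ‖∇ φ x‖ + c * C * ‖u k x‖ := by gcongr; exact hC x
  have hright : Tendsto (fun k => ∫ x, φ x • H k x) atTop (𝓝 (∫ x, φ x • G x)) := by
    refine hU.tendsto_integral (integrable_zero _ ℝ _) (mul_nonneg hM0 hc)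
      (fun k => hφ.continuous.aestronglyMeasurable.smul (hH k)) (fun k x => ?_)
      (hHG.mono fun x hx => hx.const_smul _)
    rw [norm_smul, Pi.zero_apply, zero_add, mul_assoc]
    exact mul_le_mul (hM x) (hHU k x) (norm_nonneg _) hM0
  exact tendsto_nhds_unique hleft (hright.neg.congr fun k => (h k φ hφ hφc hφΩ).symm)

theorem norm_le_norm_zero_add_mul {θ : ℝ → ℝ} {K : ℝ} (hθ : Differentiable ℝ θ)
    (hK : ∀ s, ‖deriv θ s‖ ≤ K) (s : ℝ) : ‖θ s‖ ≤ ‖θ 0‖ + K * ‖s‖ := by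
  have h : ‖θ s - θ 0‖ ≤ K * ‖s - 0‖ := Convex.norm_image_sub_le_of_norm_deriv_le
    (fun x _ => hθ x) (fun x _ => hK x) convex_univ (mem_univ 0) (mem_univ s)
  rw [sub_zero] at h
  linarith [norm_sub_norm_le (θ s) (θ 0)]

theorem IsWeakGradient.comp_contDiff (hvG : IsWeakGradient univ v G) (hv : Integrable v)
    (hG : Integrable G) {θ : ℝ → ℝ} {K : ℝ} (hθ : ContDiff ℝ 1 θ) (hK : ∀ s, ‖deriv θ s‖ ≤ K) :
    IsWeakGradient univ (fun x => θ (v x)) (fun x => deriv θ (v x) • G x) := by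
  have hθd : Differentiable ℝ θ := hθ.differentiable one_ne_zero
  have hθ' : Continuous (deriv θ) := hθ.continuous_deriv le_rfl
  obtain ⟨F, hF⟩ := hvG.exists_isSmoothApprox hv hG
  refine isWeakGradient_of_prattConvergence (w := fun k x => θ (F k x))
    (H := fun k x => deriv θ (F k x) • ∇ (F k) x) (a := ‖θ 0‖) (c := K) hF.prattConvergence
    hF.prattConvergence_gradient ((norm_nonneg _).trans (hK 0))
    (fun k => (hθ.continuous.comp (hF.contDiff k).continuous).aestronglyMeasurable)
    (fun k => ((hθ'.comp (hF.contDiff k).continuous).smul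
      (continuous_gradient (hF.contDiff k) (by simp))).aestronglyMeasurable)
    (fun k x => norm_le_norm_zero_add_mul hθd hK _) (fun k x => ?_) ?_ ?_ fun k => ?_
  · rw [norm_smul]
    exact mul_le_mul_of_nonneg_right (hK _) (norm_nonneg _)
  · exact hF.prattConvergence.tendsto.mono fun x hx => (hθ.continuous.tendsto _).comp hx
  · filter_upwards [hF.prattConvergence.tendsto, hF.prattConvergence_gradient.tendsto] with x hx hx'
    exact ((hθ'.tendsto _).comp hx).smul hx'
  · have hgrad : ∇ (fun x => θ (F k x)) = fun x => deriv θ (F k x) • ∇ (F k) x := funext fun x =>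
      gradient_fun_comp (hθd _) ((hF.contDiff k).differentiable (by simp) x)
    exact hgrad ▸ isWeakGradient_gradient (hθ.comp ((hF.contDiff k).of_le (by simp)))

end ChainRule

section SmoothTransition

theorem deriv_smoothTransition_of_nonpos {s : ℝ} (hs : s ≤ 0) :
    deriv Real.smoothTransition s = 0 :=
  IsLocalMin.deriv_eq_zero <| .of_forall fun t => by
    simpa only [Real.smoothTransition.zero_of_nonpos hs] using Real.smoothTransition.nonneg t

theorem deriv_smoothTransition_of_one_le {s : ℝ} (hs : 1 ≤ s) :
    deriv Real.smoothTransition s = 0 :=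
  IsLocalMax.deriv_eq_zero <| .of_forall fun t => by
    simpa only [Real.smoothTransition.one_of_one_le hs] using Real.smoothTransition.le_one t

/-- The Lipschitz constant of `Real.smoothTransition`, from which the cutoff functions are built. -/
noncomputable def smoothTransitionLipschitzConst : ℝ :=
  ⨆ s, |deriv Real.smoothTransition s|

theorem abs_deriv_smoothTransition_le (s : ℝ) :
    |deriv Real.smoothTransition s| ≤ smoothTransitionLipschitzConst := by
  refine le_ciSup (f := fun s => |deriv Real.smoothTransition s|) ?_ s
  have hc : HasCompactSupport (deriv Real.smoothTransition) :=
    .intro isCompact_Icc fun x hx => by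
      rcases lt_or_ge x 0 with h | h
      · exact deriv_smoothTransition_of_nonpos h.le
      · exact deriv_smoothTransition_of_one_le (not_le.mp fun h' => hx ⟨h, h'⟩).le
  obtain ⟨C, hC⟩ := (Real.smoothTransition.contDiff (n := 1)).continuous_deriv_one
    |>.bounded_above_of_compact_support hc
  exact ⟨C, forall_mem_range.mpr hC⟩

theorem smoothTransitionLipschitzConst_nonneg : 0 ≤ smoothTransitionLipschitzConst :=
  (abs_nonneg _).trans (abs_deriv_smoothTransition_le 0)

end SmoothTransition

section PosPart

/-- A smooth function that agrees with the positive part outside `(0, 1 / k)`. -/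
noncomputable def smoothPosPart (k : ℕ) (s : ℝ) : ℝ := s * Real.smoothTransition (k * s)

theorem contDiff_smoothPosPart {r : ℕ∞} (k : ℕ) : ContDiff ℝ r (smoothPosPart k) :=
  contDiff_id.mul (Real.smoothTransition.contDiff.comp (contDiff_const.mul contDiff_id))

theorem deriv_smoothPosPart (k : ℕ) (s : ℝ) : deriv (smoothPosPart k) s
    = Real.smoothTransition (k * s) + k * s * deriv Real.smoothTransition (k * s) := by
  have hst : DifferentiableAt ℝ Real.smoothTransition (k * s) :=
    (Real.smoothTransition.contDiff (n := 1)).differentiable one_ne_zero _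
  have h := (hasDerivAt_id s).mul
    (hst.hasDerivAt.comp s ((hasDerivAt_id s).const_mul (k : ℝ)))
  refine h.deriv.trans ?_
  simp only [Function.comp_apply, id, one_mul, mul_one]
  ring

theorem abs_smoothPosPart_le (k : ℕ) (s : ℝ) : |smoothPosPart k s| ≤ |s| := by
  rw [smoothPosPart, abs_mul, abs_of_nonneg (Real.smoothTransition.nonneg _)]
  exact mul_le_of_le_one_right (abs_nonneg s) (Real.smoothTransition.le_one _)

theorem abs_deriv_smoothPosPart_le (k : ℕ) (s : ℝ) :
    |deriv (smoothPosPart k) s| ≤ 1 + smoothTransitionLipschitzConst := by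
  have hmul : |k * s * deriv Real.smoothTransition (k * s)| ≤ smoothTransitionLipschitzConst := by
    rcases le_or_gt (k * s : ℝ) 0 with h | h
    · simpa [deriv_smoothTransition_of_nonpos h] using smoothTransitionLipschitzConst_nonneg
    rcases le_or_gt 1 (k * s : ℝ) with h' | h'
    · simpa [deriv_smoothTransition_of_one_le h'] using smoothTransitionLipschitzConst_nonneg
    · rw [abs_mul, abs_of_pos h]
      exact (mul_le_of_le_one_left (abs_nonneg _) h'.le).trans (abs_deriv_smoothTransition_le _)
  rw [deriv_smoothPosPart]
  refine (abs_add_le _ _).trans (add_le_add ?_ hmul)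
  rw [abs_of_nonneg (Real.smoothTransition.nonneg _)]
  exact Real.smoothTransition.le_one _

theorem eventually_one_le_natCast_mul {s : ℝ} (hs : 0 < s) : ∀ᶠ k : ℕ in atTop, 1 ≤ k * s :=
  (tendsto_natCast_atTop_atTop.atTop_mul_const hs).eventually_ge_atTop 1

theorem tendsto_smoothPosPart (s : ℝ) :
    Tendsto (fun k => smoothPosPart k s) atTop (𝓝 (max s 0)) := by
  refine tendsto_const_nhds.congr' ?_
  rcases le_or_gt s 0 with hs | hs
  · filter_upwards with k
    rw [smoothPosPart, Real.smoothTransition.zero_of_nonpos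
      (mul_nonpos_of_nonneg_of_nonpos k.cast_nonneg hs), mul_zero, max_eq_right hs]
  · filter_upwards [eventually_one_le_natCast_mul hs] with k hk
    rw [smoothPosPart, Real.smoothTransition.one_of_one_le hk, mul_one, max_eq_left hs.le]

theorem tendsto_deriv_smoothPosPart (s : ℝ) :
    Tendsto (fun k => deriv (smoothPosPart k) s) atTop (𝓝 ((Ioi 0).indicator 1 s)) := by
  refine tendsto_const_nhds.congr' ?_
  rcases le_or_gt s 0 with hs | hs
  · filter_upwards with k
    have hks : (k : ℝ) * s ≤ 0 := mul_nonpos_of_nonneg_of_nonpos k.cast_nonneg hs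
    simp [deriv_smoothPosPart, Real.smoothTransition.zero_of_nonpos hks,
      deriv_smoothTransition_of_nonpos hks, hs]
  · filter_upwards [eventually_one_le_natCast_mul hs] with k hk
    simp [deriv_smoothPosPart, Real.smoothTransition.one_of_one_le hk,
      deriv_smoothTransition_of_one_le hk, hs]

theorem IsWeakGradient.posPart {n : ℕ} {v : 𝔼 n → ℝ} {G : 𝔼 n → 𝔼 n}
    (hvG : IsWeakGradient univ v G) (hv : Integrable v) (hG : Integrable G) :
    IsWeakGradient univ (fun x => max (v x) 0) ({x | 0 < v x}.indicator G) := by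
  have hL := smoothTransitionLipschitzConst_nonneg
  have hθ : ∀ k, ContDiff ℝ 1 (smoothPosPart k) := fun k => contDiff_smoothPosPart k
  refine isWeakGradient_of_prattConvergence (w := fun k x => smoothPosPart k (v x))
    (H := fun k x => deriv (smoothPosPart k) (v x) • G x) (a := 0)
    (c := 1 + smoothTransitionLipschitzConst) (.const hv) (.const hG) (by linarith)
    (fun k => (hθ k).continuous.comp_aestronglyMeasurable hv.aestronglyMeasurable)
    (fun k => ((hθ k).continuous_deriv_one.comp_aestronglyMeasurable
      hv.aestronglyMeasurable).smul hG.aestronglyMeasurable)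
    (fun k x => ?_) (fun k x => ?_) (.of_forall fun x => tendsto_smoothPosPart _)
    (.of_forall fun x => ?_)
    (fun k => hvG.comp_contDiff hv hG (hθ k) (abs_deriv_smoothPosPart_le k))
  · rw [zero_add]
    exact (abs_smoothPosPart_le k _).trans
      (le_mul_of_one_le_left (abs_nonneg _) (by linarith))
  · rw [norm_smul]
    exact mul_le_mul_of_nonneg_right (abs_deriv_smoothPosPart_le k _) (norm_nonneg _)
  · convert (tendsto_deriv_smoothPosPart (v x)).smul_const (G x) using 2
    by_cases h : 0 < v x <;> simp [h]

end PosPart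

section LocalCalculus

variable {n : ℕ} {Ω Ω' : Set (𝔼 n)} {v w : 𝔼 n → ℝ} {G H : 𝔼 n → 𝔼 n} {η : 𝔼 n → ℝ}

theorem IsWeakGradient.mono (hvG : IsWeakGradient Ω v G) (h : Ω' ⊆ Ω) :
    IsWeakGradient Ω' v G := by
  rw [isWeakGradient_iff] at hvG ⊢
  exact fun φ hφ hφc hφΩ => hvG φ hφ hφc (hφΩ.trans h)

theorem IsWeakGradient.contDiff_mul (hvG : IsWeakGradient Ω v G) (hv : LocallyIntegrableOn v Ω)
    (hG : LocallyIntegrableOn G Ω) (hη : ContDiff ℝ ∞ η) (hηΩ : tsupport η ⊆ Ω) :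
    IsWeakGradient univ (fun x => η x * v x) (fun x => η x • G x + v x • ∇ η x) := by
  rw [isWeakGradient_iff] at hvG ⊢
  intro φ hφ hφc _
  have hη' := continuous_gradient hη (by simp)
  have hφ' := continuous_gradient hφ (by simp)
  have hηφ : tsupport (fun x => η x * φ x) ⊆ Ω := tsupport_mul_subset_left.trans hηΩ
  have hηφc : HasCompactSupport fun x => η x * φ x := hφc.mul_left
  have i₁ : Integrable fun x => v x • η x • ∇ φ x :=
    integrable_smul_of_tsupport_subset' (hη.continuous.smul hφ')
      ((hasCompactSupport_gradient hφc).smul_left (f := η))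
      ((tsupport_smul_subset_left η (∇ φ)).trans hηΩ) hv
  have i₂ : Integrable fun x => v x • φ x • ∇ η x :=
    integrable_smul_of_tsupport_subset' (hφ.continuous.smul hη') hφc.smul_right
      ((tsupport_smul_subset_right φ _).trans ((tsupport_gradient_subset η).trans hηΩ)) hv
  have i₃ : Integrable fun x => (η x * φ x) • G x :=
    integrable_smul_of_tsupport_subset (hη.continuous.mul hφ.continuous) hηφc hηφ hG
  have hgrad : ∀ x, ∇ (fun y => η y * φ y) x = η x • ∇ φ x + φ x • ∇ η x := fun x =>
    gradient_fun_mul (hη.differentiable (by simp) x) (hφ.differentiable (by simp) x)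
  have htest := hvG _ (hη.mul hφ) hηφc hηφ
  simp only [hgrad, smul_add] at htest
  rw [integral_add i₁ i₂, ← eq_sub_iff_add_eq] at htest
  calc ∫ x, (η x * v x) • ∇ φ x = ∫ x, v x • η x • ∇ φ x := by simp only [smul_smul, mul_comm]
    _ = -∫ x, ((η x * φ x) • G x + v x • φ x • ∇ η x) := by
      rw [htest, integral_add i₃ i₂]
      abel
    _ = -∫ x, φ x • (η x • G x + v x • ∇ η x) := by simp only [smul_add, smul_smul, mul_comm]

theorem exists_contDiff_hasCompactSupport_one_nhdsSet {E : Type*} [NormedAddCommGroup E]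
    [NormedSpace ℝ E] [FiniteDimensional ℝ E] {K U : Set E} (hK : IsCompact K) (hU : IsOpen U)
    (hKU : K ⊆ U) :
    ∃ η : E → ℝ, ContDiff ℝ ∞ η ∧ HasCompactSupport η ∧ tsupport η ⊆ U ∧ ∀ᶠ x in 𝓝ˢ K, η x = 1 := by
  obtain ⟨L, hL, hKL, hLU⟩ := exists_compact_between hK hU hKU
  obtain ⟨η, hη1, hη0, -⟩ :=
    exists_contMDiffMap_one_nhds_of_subset_interior (n := ⊤) (modelWithCornersSelf ℝ E)
      hK.isClosed hKL
  have hηL : tsupport η ⊆ L :=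
    closure_minimal (fun x hx => by_contra fun h => hx (hη0 x h)) hL.isClosed
  exact ⟨η, η.contMDiff.contDiff, hL.of_isClosed_subset (isClosed_tsupport _) hηL,
    hηL.trans hLU, hη1⟩

theorem IsWeakGradient.posPart_sub_const (hΩ : IsOpen Ω) (hvG : IsWeakGradient Ω v G)
    (hv : LocallyIntegrableOn v Ω) (hG : LocallyIntegrableOn G Ω) (l : ℝ) :
    IsWeakGradient Ω (fun x => max (v x - l) 0) ({x | l < v x}.indicator G) := by
  rw [isWeakGradient_iff]
  intro φ hφ hφc hφΩ
  obtain ⟨η, hη, hηc, hηΩ, hη1⟩ := exists_contDiff_hasCompactSupport_one_nhdsSet hφc hΩ hφΩ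
  have hvl : LocallyIntegrableOn (fun x => v x - l) Ω := hv.sub (locallyIntegrableOn_const l)
  have hη' := continuous_gradient hη (by simp)
  have hηφ : ∀ x ∈ tsupport φ, η x = 1 ∧ ∇ η x = 0 := fun x hx => by
    have h : η =ᶠ[𝓝 x] fun _ => 1 := hη1.filter_mono (nhds_le_nhdsSet hx)
    exact ⟨h.eq_of_nhds, by rw [h.gradient_eq, gradient_fun_const]⟩
  have hconst : IsWeakGradient Ω (fun _ => l) 0 := by
    convert (isWeakGradient_gradient (contDiff_const (c := l))).mono (subset_univ Ω) using 1
    exact funext fun _ => (gradient_fun_const _ _).symm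
  have hvlG : IsWeakGradient Ω (fun x => v x - l) G := by
    simpa using hvG.sub hv hG (locallyIntegrableOn_const l) locallyIntegrableOn_zero hconst
  refine (integral_congr_ae (.of_forall fun x => ?_)).trans <| (isWeakGradient_iff.mp
    ((hvlG.contDiff_mul hvl hG hη hηΩ).posPart
    (integrable_smul_of_tsupport_subset hη.continuous hηc hηΩ hvl)
    ((integrable_smul_of_tsupport_subset hη.continuous hηc hηΩ hG).add
      (integrable_smul_of_tsupport_subset' hη' (hasCompactSupport_gradient hηc)
        ((tsupport_gradient_subset η).trans hηΩ) hvl))) φ hφ hφc (subset_univ _)).trans <|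
    congrArg _ (integral_congr_ae (.of_forall fun x => ?_))
  all_goals
    by_cases hx : x ∈ tsupport φ
    · simp [hηφ x hx, indicator]
    · simp [image_eq_zero_of_notMem_tsupport hx, gradient_of_notMem_tsupport hx]

theorem IsWeakGradient.lintegral_rpow_le (hn : 2 ≤ n) (hvG : IsWeakGradient univ v G)
    (hv : Integrable v) (hG : Integrable G) (hvc : HasCompactSupport v) :
    ∫⁻ x, ‖v x‖ₑ ^ (n / (n - 1) : ℝ) ≤
      lintegralPowLePowLIntegralFDerivConst (volume : Measure (𝔼 n)) (n / (n - 1)) *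
        (∫⁻ x, ‖G x‖ₑ) ^ (n / (n - 1) : ℝ) := by
  have hn1 : (1 : ℝ) < n := by exact_mod_cast hn
  set q : ℝ := n / (n - 1)
  have : 0 ≤ q := div_nonneg (by linarith) (by linarith)
  have hconj : Real.HolderConjugate (Module.finrank ℝ (𝔼 n)) q := by
    simpa [Real.conjExponent] using Real.HolderConjugate.conjExponent hn1
  set C := lintegralPowLePowLIntegralFDerivConst (volume : Measure (𝔼 n)) q
  obtain ⟨F, hF⟩ := hvG.exists_isSmoothApprox hv hG
  have hFk : ∀ k, ∫⁻ x, ‖F k x‖ₑ ^ q ≤ C * (∫⁻ x, ‖G x‖ₑ) ^ q := fun k => by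
    refine (lintegral_pow_le_pow_lintegral_fderiv volume ((hF.contDiff k).of_le (by simp))
      (hF.hasCompactSupport hvc k) hconj).trans ?_
    have hgrad : ∫⁻ x, ‖fderiv ℝ (F k) x‖ₑ ≤ ∫⁻ x, ‖G x‖ₑ := by
      simp_rw [← ofReal_norm (fderiv ℝ (F k) _), ← norm_gradient, ofReal_norm]
      rw [← ofReal_integral_norm_eq_lintegral_enorm (hF.prattConvergence_gradient.integrable k),
        ← ofReal_integral_norm_eq_lintegral_enorm hG]
      exact ENNReal.ofReal_le_ofReal (hF.prattConvergence_gradient.integral_norm_le k)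
    gcongr
  calc ∫⁻ x, ‖v x‖ₑ ^ q ≤ ∫⁻ x, liminf (fun k => ‖F k x‖ₑ ^ q) atTop := by
        refine lintegral_mono_ae (hF.prattConvergence.tendsto.mono fun x hx => ?_)
        exact ((ENNReal.continuous_rpow_const.tendsto _).comp hx.enorm).liminf_eq.ge
    _ ≤ liminf (fun k => ∫⁻ x, ‖F k x‖ₑ ^ q) atTop :=
        lintegral_liminf_le fun k => (hF.contDiff k).continuous.measurable.enorm.pow_const q
    _ ≤ liminf (fun _ : ℕ => C * (∫⁻ x, ‖G x‖ₑ) ^ q) atTop :=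
        liminf_le_liminf (.of_forall hFk)
    _ = C * (∫⁻ x, ‖G x‖ₑ) ^ q := liminf_const _

end LocalCalculus

section MemW1pLoc

theorem memLp_smul_of_hasCompactSupport {X F : Type*} [TopologicalSpace X] [T2Space X]
    [MeasurableSpace X] [OpensMeasurableSpace X] {μ : Measure X} [IsFiniteMeasureOnCompacts μ]
    [NormedAddCommGroup F] [NormedSpace ℝ F] {p : ENNReal} {ψ : X → ℝ} {g : X → F}
    (hψ : Continuous ψ) (hψc : HasCompactSupport ψ) (hg : MemLp g p (μ.restrict (tsupport ψ))) :
    MemLp (fun x => ψ x • g x) p μ := by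
  have hsupp : (tsupport ψ).indicator (fun x => ψ x • g x) = fun x => ψ x • g x :=
    indicator_eq_self.mpr fun x hx => subset_tsupport ψ (left_ne_zero_of_smul hx)
  rw [← hsupp, memLp_indicator_iff_restrict (isClosed_tsupport ψ).measurableSet]
  exact hg.smul ((hψ.memLp_top_of_hasCompactSupport hψc μ).restrict _)

theorem memLp_smul_of_hasCompactSupport' {X F : Type*} [TopologicalSpace X] [T2Space X]
    [MeasurableSpace X] [OpensMeasurableSpace X] {μ : Measure X} [IsFiniteMeasureOnCompacts μ]
    [NormedAddCommGroup F] [NormedSpace ℝ F] [SecondCountableTopologyEither X F] {p : ENNReal}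
    {v : X → ℝ} {ψ : X → F} (hψ : Continuous ψ) (hψc : HasCompactSupport ψ)
    (hv : MemLp v p (μ.restrict (tsupport ψ))) : MemLp (fun x => v x • ψ x) p μ := by
  have hsupp : (tsupport ψ).indicator (fun x => v x • ψ x) = fun x => v x • ψ x :=
    indicator_eq_self.mpr fun x hx => subset_tsupport ψ (right_ne_zero_of_smul hx)
  rw [← hsupp, memLp_indicator_iff_restrict (isClosed_tsupport ψ).measurableSet]
  exact ((hψ.memLp_top_of_hasCompactSupport hψc μ).restrict _).smul hv

variable {n : ℕ} {p : ℝ} {Ω Ω' : Set (𝔼 n)} {v w : 𝔼 n → ℝ} {G H : 𝔼 n → 𝔼 n}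

theorem MemW1pLoc.locallyIntegrableOn (hp : 1 ≤ p) (hΩ : IsOpen Ω) (hv : MemW1pLoc p Ω v G) :
    LocallyIntegrableOn v Ω :=
  (locallyIntegrableOn_iff hΩ.isLocallyClosed).mpr fun K hKΩ hK => by
    have := isFiniteMeasure_restrict.mpr (hK.measure_ne_top (μ := volume))
    exact (hv.memLp K hK hKΩ).integrable (ENNReal.one_le_ofReal.mpr hp)

theorem MemW1pLoc.locallyIntegrableOn_gradient (hp : 1 ≤ p) (hΩ : IsOpen Ω)
    (hv : MemW1pLoc p Ω v G) : LocallyIntegrableOn G Ω :=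
  (locallyIntegrableOn_iff hΩ.isLocallyClosed).mpr fun K hKΩ hK => by
    have := isFiniteMeasure_restrict.mpr (hK.measure_ne_top (μ := volume))
    exact (hv.memLp_gradient K hK hKΩ).integrable (ENNReal.one_le_ofReal.mpr hp)

theorem MemW1pLoc.mono (hv : MemW1pLoc p Ω v G) (h : Ω' ⊆ Ω) : MemW1pLoc p Ω' v G where
  memLp K hK hKΩ := hv.memLp K hK (hKΩ.trans h)
  memLp_gradient K hK hKΩ := hv.memLp_gradient K hK (hKΩ.trans h)
  isWeakGradient := hv.isWeakGradient.mono h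

theorem MemW1pLoc.sub (hp : 1 ≤ p) (hΩ : IsOpen Ω) (hv : MemW1pLoc p Ω v G)
    (hw : MemW1pLoc p Ω w H) :
    MemW1pLoc p Ω (fun x => v x - w x) (fun x => G x - H x) where
  memLp K hK hKΩ := (hv.memLp K hK hKΩ).sub (hw.memLp K hK hKΩ)
  memLp_gradient K hK hKΩ := (hv.memLp_gradient K hK hKΩ).sub (hw.memLp_gradient K hK hKΩ)
  isWeakGradient := hv.isWeakGradient.sub (hv.locallyIntegrableOn hp hΩ)
    (hv.locallyIntegrableOn_gradient hp hΩ) (hw.locallyIntegrableOn hp hΩ)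
    (hw.locallyIntegrableOn_gradient hp hΩ) hw.isWeakGradient

theorem MemW1pLoc.posPart_sub_const (hp : 1 ≤ p) (hΩ : IsOpen Ω) (hvm : Measurable v)
    (hv : MemW1pLoc p Ω v G) (l : ℝ) :
    MemW1pLoc p Ω (fun x => max (v x - l) 0) ({x | l < v x}.indicator G) where
  memLp K hK hKΩ := by
    have := isFiniteMeasure_restrict.mpr (hK.measure_ne_top (μ := volume))
    exact ((hv.memLp K hK hKΩ).sub (memLp_const l)).pos_part
  memLp_gradient K hK hKΩ :=
    (hv.memLp_gradient K hK hKΩ).indicator (measurableSet_lt measurable_const hvm)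
  isWeakGradient := hv.isWeakGradient.posPart_sub_const hΩ (hv.locallyIntegrableOn hp hΩ)
    (hv.locallyIntegrableOn_gradient hp hΩ) l

theorem MemW1pLoc.contDiff_mul (hp : 1 ≤ p) (hΩ : IsOpen Ω) (hv : MemW1pLoc p Ω v G)
    {η : 𝔼 n → ℝ} (hη : ContDiff ℝ ∞ η) (hηc : HasCompactSupport η) (hηΩ : tsupport η ⊆ Ω) :
    MemW1pLoc p univ (fun x => η x * v x) (fun x => η x • G x + v x • ∇ η x) where
  memLp K _ _ := MemLp.restrict (μ := volume) K
    (memLp_smul_of_hasCompactSupport hη.continuous hηc (hv.memLp _ hηc hηΩ))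
  memLp_gradient K _ _ := by
    have hηc' := hasCompactSupport_gradient hηc
    exact MemLp.restrict (μ := volume) K ((memLp_smul_of_hasCompactSupport hη.continuous hηc
      (hv.memLp_gradient _ hηc hηΩ)).add
      (memLp_smul_of_hasCompactSupport' (continuous_gradient hη (by simp)) hηc'
        (hv.memLp _ hηc' ((tsupport_gradient_subset η).trans hηΩ))))
  isWeakGradient := hv.isWeakGradient.contDiff_mul (hv.locallyIntegrableOn hp hΩ)
    (hv.locallyIntegrableOn_gradient hp hΩ) hη hηΩ

end MemW1pLoc

section RadialCutoff

variable {V : Type*} [NormedAddCommGroup V] {s t : ℝ} {x : V}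

/-- A smooth radial cutoff function, equal to `1` on the ball of radius `s` and to `0` outside the
ball of radius `t`. The squared norm keeps it smooth at the origin. -/
noncomputable def radialCutoff (s t : ℝ) (x : V) : ℝ :=
  Real.smoothTransition ((t ^ 2 - ‖x‖ ^ 2) / (t ^ 2 - s ^ 2))

theorem radialCutoff_mem_Icc (s t : ℝ) (x : V) : radialCutoff s t x ∈ Icc (0 : ℝ) 1 :=
  ⟨Real.smoothTransition.nonneg _, Real.smoothTransition.le_one _⟩

theorem radialCutoff_of_norm_le (hs : 0 ≤ s) (hst : s < t) (hx : ‖x‖ ≤ s) :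
    radialCutoff s t x = 1 := by
  refine Real.smoothTransition.one_of_one_le ?_
  rw [one_le_div (by nlinarith)]
  gcongr

theorem radialCutoff_of_le_norm (hs : 0 ≤ s) (hst : s < t) (hx : t ≤ ‖x‖) :
    radialCutoff s t x = 0 :=
  Real.smoothTransition.zero_of_nonpos
    (div_nonpos_of_nonpos_of_nonneg (by nlinarith) (by nlinarith))

theorem tsupport_radialCutoff_subset (hs : 0 ≤ s) (hst : s < t) :
    tsupport (radialCutoff s t : V → ℝ) ⊆ Metric.closedBall 0 t := by
  refine closure_minimal (fun x hx => ?_) Metric.isClosed_closedBall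
  rw [mem_closedBall_zero_iff]
  exact (not_le.mp fun h => hx (radialCutoff_of_le_norm hs hst h)).le

theorem hasCompactSupport_radialCutoff [ProperSpace V] (hs : 0 ≤ s) (hst : s < t) :
    HasCompactSupport (radialCutoff s t : V → ℝ) :=
  (isCompact_closedBall _ _).of_isClosed_subset (isClosed_tsupport _)
    (tsupport_radialCutoff_subset hs hst)

variable [InnerProductSpace ℝ V]

theorem contDiff_radialCutoff : ContDiff ℝ ∞ (radialCutoff s t : V → ℝ) :=
  Real.smoothTransition.contDiff.comp ((contDiff_const.sub (contDiff_norm_sq ℝ)).div_const _)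

variable [CompleteSpace V]

theorem gradient_radialCutoff_of_norm_le (hs : 0 ≤ s) (hst : s < t) (hx : ‖x‖ ≤ s) :
    ∇ (radialCutoff s t) x = 0 := by
  have hmax : IsLocalMax (radialCutoff s t) x := .of_forall fun y =>
    (radialCutoff_mem_Icc s t y).2.trans_eq (radialCutoff_of_norm_le hs hst hx).symm
  rw [gradient, hmax.fderiv_eq_zero, map_zero]

theorem gradient_radialCutoff_of_le_norm (hs : 0 ≤ s) (hst : s < t) (hx : t ≤ ‖x‖) :
    ∇ (radialCutoff s t) x = 0 := by
  have hmin : IsLocalMin (radialCutoff s t) x := .of_forall fun y =>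
    (radialCutoff_of_le_norm hs hst hx).trans_le (radialCutoff_mem_Icc s t y).1
  rw [gradient, hmin.fderiv_eq_zero, map_zero]

theorem norm_gradient_radialCutoff_le (hs : 0 ≤ s) (hst : s < t) (x : V) :
    ‖∇ (radialCutoff s t) x‖ ≤ 2 * smoothTransitionLipschitzConst / (t - s) := by
  have hL := smoothTransitionLipschitzConst_nonneg
  have hts : 0 < t - s := sub_pos.mpr hst
  rcases le_total t ‖x‖ with hx | hx
  · rw [gradient_radialCutoff_of_le_norm hs hst hx, norm_zero]
    positivity
  have hpos : 0 < t ^ 2 - s ^ 2 := by nlinarith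
  have hinner : HasFDerivAt (fun y : V => (t ^ 2 - s ^ 2)⁻¹ * (t ^ 2 - ‖y‖ ^ 2))
      ((t ^ 2 - s ^ 2)⁻¹ • (-(2 • innerSL ℝ x) : V →L[ℝ] ℝ)) x :=
    ((hasStrictFDerivAt_norm_sq x).hasFDerivAt.const_sub (t ^ 2)).const_mul _
  have hcutoff : HasFDerivAt (radialCutoff s t) _ x :=
    ((Real.smoothTransition.contDiffAt (n := 1)).differentiableAt
      one_ne_zero).hasDerivAt.comp_hasFDerivAt x (by simpa only [div_eq_inv_mul] using hinner)
  rw [norm_gradient, hcutoff.fderiv, norm_smul, norm_smul, norm_neg, Real.norm_eq_abs,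
    Real.norm_of_nonneg (inv_nonneg.mpr hpos.le), ← Nat.cast_smul_eq_nsmul ℝ, norm_smul,
    innerSL_apply_norm]
  calc _ ≤ smoothTransitionLipschitzConst * ((t ^ 2 - s ^ 2)⁻¹ * (2 * (t + s))) := by
        gcongr
        · exact abs_deriv_smoothTransition_le _
        · simp
        · linarith
    _ = 2 * smoothTransitionLipschitzConst / (t - s) := by
        have : t + s ≠ 0 := by linarith
        rw [sq_sub_sq]
        field_simp

end RadialCutoff

section Truncation

variable {n : ℕ} {p l : ℝ} {Ω : Set (𝔼 n)} {η u : 𝔼 n → ℝ} {G : 𝔼 n → 𝔼 n} {x : 𝔼 n}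

/-- The truncation `η (u - l)₊` of `u` above the level `l`, localized by a cutoff function `η`. -/
noncomputable def truncation (η : 𝔼 n → ℝ) (l : ℝ) (u : 𝔼 n → ℝ) (x : 𝔼 n) : ℝ :=
  η x * max (u x - l) 0

/-- The weak gradient of `truncation η l u`, where `G` is the weak gradient of `u`. -/
noncomputable def truncationGradient (η : 𝔼 n → ℝ) (l : ℝ) (u : 𝔼 n → ℝ) (G : 𝔼 n → 𝔼 n)
    (x : 𝔼 n) : 𝔼 n :=
  η x • {y | l < u y}.indicator G x + max (u x - l) 0 • ∇ η x

theorem truncation_of_le (hx : u x ≤ l) : truncation η l u x = 0 := by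
  simp [truncation, hx]

theorem truncationGradient_of_le (hx : u x ≤ l) : truncationGradient η l u G x = 0 := by
  simp [truncationGradient, hx]

theorem sub_truncation_mem_Icc (hη : η x ∈ Icc (0 : ℝ) 1) (hx : l ≤ u x) :
    u x - truncation η l u x ∈ Icc l (u x) := by
  rw [truncation, max_eq_left (sub_nonneg.mpr hx)]
  constructor <;> nlinarith [hη.1, hη.2]

theorem norm_truncationGradient_le (hη : η x ∈ Icc (0 : ℝ) 1) :
    ‖truncationGradient η l u G x‖ ≤ ‖G x‖ + max (u x - l) 0 * ‖∇ η x‖ := by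
  refine (norm_add_le _ _).trans (add_le_add ?_ ?_)
  · rw [norm_smul, Real.norm_of_nonneg hη.1]
    exact (mul_le_of_le_one_left (norm_nonneg _) hη.2).trans (norm_indicator_le_norm_self _ _)
  · rw [norm_smul, Real.norm_of_nonneg (le_max_right _ _)]

theorem measurable_truncation (hη : Measurable η) (hu : Measurable u) :
    Measurable (truncation η l u) :=
  hη.mul ((hu.sub_const l).max measurable_const)

theorem measurable_truncationGradient (hη : ContDiff ℝ 1 η) (hu : Measurable u)
    (hG : Measurable G) : Measurable (truncationGradient η l u G) :=
  (hη.continuous.measurable.smul (hG.indicator (measurableSet_lt measurable_const hu))).add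
    (((hu.sub_const l).max measurable_const).smul (continuous_gradient hη one_ne_zero).measurable)

theorem MemW1pLoc.truncation (hp : 1 ≤ p) (hΩ : IsOpen Ω) (hum : Measurable u)
    (hu : MemW1pLoc p Ω u G) (hη : ContDiff ℝ ∞ η) (hηc : HasCompactSupport η)
    (hηΩ : tsupport η ⊆ Ω) :
    MemW1pLoc p univ (truncation η l u) (truncationGradient η l u G) :=
  (hu.posPart_sub_const hp hΩ hum l).contDiff_mul hp hΩ hη hηc hηΩ

theorem admissible_sub_truncation (hp : 1 ≤ p) (hΩ : IsOpen Ω) (hum : Measurable u)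
    (hu : Admissible p Ω u G) (hl : -1 ≤ l) (hη : ContDiff ℝ ∞ η) (hηc : HasCompactSupport η)
    (hηΩ : tsupport η ⊆ Ω) (hη01 : ∀ x, η x ∈ Icc (0 : ℝ) 1) :
    Admissible p Ω (fun x => u x - truncation η l u x)
      (fun x => G x - truncationGradient η l u G x) := by
  refine ⟨hu.1.sub hp hΩ ((hu.1.truncation hp hΩ hum hη hηc hηΩ).mono (subset_univ Ω)), ?_⟩
  filter_upwards [hu.2] with x hx
  rcases le_total (u x) l with h | h
  · rwa [truncation_of_le h, sub_zero]
  · exact Icc_subset_Icc hl hx.2 (sub_truncation_mem_Icc (hη01 x) h)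

theorem norm_truncationGradient_radialCutoff_le {s t : ℝ} (hs : 0 ≤ s) (hst : s < t)
    (hul : u x - l ≤ 2) :
    ‖truncationGradient (radialCutoff s t) l u G x‖
      ≤ ‖G x‖ + 4 * smoothTransitionLipschitzConst * (t - s)⁻¹ := by
  refine (norm_truncationGradient_le (radialCutoff_mem_Icc s t x)).trans (add_le_add_right ?_ _)
  calc max (u x - l) 0 * ‖∇ (radialCutoff s t) x‖
      ≤ 2 * (2 * smoothTransitionLipschitzConst / (t - s)) :=
        mul_le_mul (max_le hul zero_le_two) (norm_gradient_radialCutoff_le hs hst x)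
          (norm_nonneg _) zero_le_two
    _ = 4 * smoothTransitionLipschitzConst * (t - s)⁻¹ := by ring

end Truncation

section EnergyComparison

variable {n : ℕ} {p m lam : ℝ} {F : 𝔼 n → ℝ → 𝔼 n → ℝ} {W : ℝ → 𝔼 n → ℝ} {Ω : Set (𝔼 n)}
  {u v : 𝔼 n → ℝ} {G H : 𝔼 n → 𝔼 n} {l s t σ b c τ τ' : ℝ} {x ξ : 𝔼 n}

theorem AssumptionB.nonneg (hB : AssumptionB m lam W) (hlam : 0 < lam)
    (hτ : τ ∈ Icc (-1 : ℝ) 1) : 0 ≤ W τ x := by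
  have : 0 ≤ 1 - τ ^ 2 := by nlinarith [hτ.1, hτ.2]
  exact (by positivity : 0 ≤ lam⁻¹ * (1 - τ ^ 2) ^ m).trans (hB τ x hτ).1

theorem AssumptionB.le (hB : AssumptionB m lam W) (hm : 0 ≤ m) (hlam : 0 < lam)
    (hτ : τ ∈ Icc (-1 : ℝ) 1) : W τ x ≤ lam :=
  (hB τ x hτ).2.trans <| mul_le_of_le_one_right hlam.le <|
    Real.rpow_le_one (by nlinarith [hτ.1, hτ.2]) (by nlinarith [sq_nonneg τ]) hm

theorem AssumptionA.apply_zero (hA : AssumptionA p lam F) (hp : p ≠ 0)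
    (hτ : τ ∈ Icc (-1 : ℝ) 1) : F 0 τ x = 0 := by
  have h := hA 0 τ x hτ
  rw [norm_zero, Real.zero_rpow hp, mul_zero, mul_zero] at h
  exact le_antisymm h.2 h.1

theorem add_le_integrand (hA : AssumptionA p lam F) (hC : AssumptionC W) (hc : c ≤ lam⁻¹)
    (hl : -1 ≤ l) (hσ : σ ≤ 0) (hgap : ∀ τ, σ < τ → τ ≤ b → W l x + c ≤ W τ x) (hlτ : l ≤ τ)
    (hτ : τ ≤ 1) (hτb : τ ≤ b) :
    W l x + c * (‖ξ‖ ^ p + if σ < τ then 1 else 0) ≤ F ξ τ x + W τ x := by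
  have hF := (hA ξ τ x ⟨hl.trans hlτ, hτ⟩).1
  have hcF : c * ‖ξ‖ ^ p ≤ lam⁻¹ * ‖ξ‖ ^ p := by gcongr
  have hW : W l x + c * (if σ < τ then 1 else 0) ≤ W τ x := by
    split_ifs with hστ
    · rw [mul_one]
      exact hgap τ hστ hτb
    · rw [mul_zero, add_zero]
      have hτ0 := (not_lt.mp hστ).trans hσ
      exact (hC x).1 ⟨hl, hlτ.trans hτ0⟩ ⟨hl.trans hlτ, hτ0⟩ hlτ
  linarith

theorem integrand_le_add (hA : AssumptionA p lam F) (hB : AssumptionB m lam W)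
    (hC : AssumptionC W) (hm : 0 ≤ m) (hlam : 0 < lam) (hσ : σ ≤ 0) (hτ' : -1 ≤ τ')
    (hττ' : τ' ≤ τ) (hτ : τ ≤ 1) :
    F ξ τ' x + W τ' x ≤ W τ x + lam * (‖ξ‖ ^ p + if σ < τ then 1 else 0) := by
  have hτ'1 : τ' ∈ Icc (-1 : ℝ) 1 := ⟨hτ', hττ'.trans hτ⟩
  have hτ1 : τ ∈ Icc (-1 : ℝ) 1 := ⟨hτ'.trans hττ', hτ⟩
  have hF := (hA ξ τ' x hτ'1).2
  have hW : W τ' x ≤ W τ x + lam * if σ < τ then 1 else 0 := by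
    split_ifs with hστ
    · linarith [hB.le hm hlam hτ'1 (x := x), hB.nonneg hlam hτ1 (x := x)]
    · rw [mul_zero, add_zero]
      have hτ0 := (not_lt.mp hστ).trans hσ
      exact (hC x).1 ⟨hτ', hττ'.trans hτ0⟩ ⟨hτ1.1, hτ0⟩ hττ'
  linarith

/-- A minimizer in the open set `Ω` together with its weak gradient `G`, both of them measurable on
the whole space and with the bounds on `u` holding at every point. -/
structure IsMeasurableMinimizer (p : ℝ) (F : 𝔼 n → ℝ → 𝔼 n → ℝ) (W : ℝ → 𝔼 n → ℝ)
    (Ω : Set (𝔼 n)) (u : 𝔼 n → ℝ) (G : 𝔼 n → 𝔼 n) : Prop where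
  isOpen : IsOpen Ω
  measurable : Measurable u
  measurable_gradient : Measurable G
  mem_Icc : ∀ x, u x ∈ Icc (-1 : ℝ) 1
  memW1pLoc : MemW1pLoc p Ω u G
  energy_le : ∀ D : Set (𝔼 n), IsOpen D → Bornology.IsBounded D → closure D ⊆ Ω →
    ∀ (v : 𝔼 n → ℝ) (H : 𝔼 n → 𝔼 n), Admissible p Ω v H → (∀ x ∉ D, v x = u x) →
      energy F W u G D ≤ energy F W v H D

theorem MemW1pLoc.integrableOn_norm_rpow (h : MemW1pLoc p Ω u G) (hp : 0 < p) {K : Set (𝔼 n)}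
    (hK : IsCompact K) (hKΩ : K ⊆ Ω) : IntegrableOn (fun x => ‖G x‖ ^ p) K := by
  have h' := (h.memLp_gradient K hK hKΩ).integrable_norm_rpow (by simpa using hp) (by simp)
  rwa [ENNReal.toReal_ofReal hp.le] at h'

theorem IsMeasurableMinimizer.energy_ne_top (h : IsMeasurableMinimizer p F W Ω u G)
    (hA : AssumptionA p lam F) (hB : AssumptionB m lam W) (hp : 0 < p) (hm : 0 ≤ m)
    (hlam : 0 < lam) {K : Set (𝔼 n)} (hK : IsCompact K) (hKΩ : K ⊆ Ω) :
    energy F W u G K ≠ ⊤ := by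
  have hi : IntegrableOn (fun x => lam * ‖G x‖ ^ p + lam) K :=
    ((h.memW1pLoc.integrableOn_norm_rpow hp hK hKΩ).const_mul lam).add
      (integrableOn_const hK.measure_ne_top)
  refine ((lintegral_mono fun x => ENNReal.ofReal_le_ofReal ?_).trans_lt hi.lintegral_lt_top).ne
  exact add_le_add (hA _ _ _ (h.mem_Icc x)).2 (hB.le hm hlam (h.mem_Icc x))

theorem IsMeasurableMinimizer.energy_le_of_subset (h : IsMeasurableMinimizer p F W Ω u G)
    {D N : Set (𝔼 n)} (hD : IsOpen D) (hDb : Bornology.IsBounded D) (hDΩ : closure D ⊆ Ω)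
    (hN : MeasurableSet N) (hND : N ⊆ D) (hfin : energy F W u G D ≠ ⊤) (hv : Admissible p Ω v H)
    (hvu : ∀ x ∉ N, v x = u x) (hHG : ∀ x ∈ D \ N, H x = G x) :
    energy F W u G N ≤ energy F W v H N := by
  have hDN : energy F W v H (D \ N) = energy F W u G (D \ N) :=
    setLIntegral_congr_fun (hD.measurableSet.diff hN) fun x hx => by
      simp only [hvu x hx.2, hHG x hx]
  have hmin := h.energy_le D hD hDb hDΩ v H hv fun x hx => hvu x fun hxN => hx (hND hxN)
  have hsplit : ∀ (w : 𝔼 n → ℝ) (K : 𝔼 n → 𝔼 n),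
      energy F W w K D = energy F W w K N + energy F W w K (D \ N) := fun w K => by
    simpa only [energy, inter_eq_self_of_subset_right hND] using
      (lintegral_inter_add_sdiff (μ := volume)
        (fun x => ENNReal.ofReal (F (K x) (w x) x + W (w x) x)) D hN).symm
  rw [hsplit u G, hsplit v H, hDN] at hmin
  exact (ENNReal.add_le_add_iff_right
    (ne_top_of_le_ne_top hfin (lintegral_mono_set sdiff_subset))).mp hmin

/-- The part of the ball of radius `r` around the origin where `u` is above the level `l`. -/
def superlevel (u : 𝔼 n → ℝ) (l r : ℝ) : Set (𝔼 n) :=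
  {x | ‖x‖ < r ∧ l < u x}

theorem measurableSet_superlevel (hu : Measurable u) (l r : ℝ) :
    MeasurableSet (superlevel u l r) :=
  (measurableSet_lt measurable_norm measurable_const).inter (measurableSet_lt measurable_const hu)

theorem superlevel_subset_ball (u : 𝔼 n → ℝ) (l r : ℝ) :
    superlevel u l r ⊆ Metric.ball 0 r := fun _ hx => mem_ball_zero_iff.mpr hx.1

theorem superlevel_mono (u : 𝔼 n → ℝ) {l l' r r' : ℝ} (hl : l ≤ l') (hr : r' ≤ r) :
    superlevel u l' r' ⊆ superlevel u l r :=
  fun _ hx => ⟨hx.1.trans_le hr, hl.trans_lt hx.2⟩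

theorem volume_superlevel_ne_top (u : 𝔼 n → ℝ) (l r : ℝ) : volume (superlevel u l r) ≠ ⊤ :=
  ((measure_mono (superlevel_subset_ball u l r)).trans_lt measure_ball_lt_top).ne

theorem IsMeasurableMinimizer.energy_superlevel_le (h : IsMeasurableMinimizer p F W Ω u G)
    (hA : AssumptionA p lam F) (hB : AssumptionB m lam W) (hp : 1 ≤ p) (hm : 0 ≤ m)
    (hlam : 0 < lam) (hΩ : Metric.closedBall 0 t ⊆ Ω) (hl : -1 ≤ l) (hs : 0 ≤ s) (hst : s < t) :
    energy F W u G (superlevel u l t) ≤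
      energy F W (fun x => u x - truncation (radialCutoff s t) l u x)
        (fun x => G x - truncationGradient (radialCutoff s t) l u G x) (superlevel u l t) := by
  have hfin : energy F W u G (Metric.ball 0 t) ≠ ⊤ :=
    ne_top_of_le_ne_top
      (h.energy_ne_top hA hB (by linarith) hm hlam (isCompact_closedBall 0 t) hΩ)
      (lintegral_mono_set Metric.ball_subset_closedBall)
  refine h.energy_le_of_subset Metric.isOpen_ball Metric.isBounded_ball
    (Metric.closure_ball_subset_closedBall.trans hΩ) (measurableSet_superlevel h.measurable l t)
    (superlevel_subset_ball u l t) hfin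
    (admissible_sub_truncation hp h.isOpen h.measurable ⟨h.memW1pLoc, .of_forall h.mem_Icc⟩ hl
      contDiff_radialCutoff (hasCompactSupport_radialCutoff hs hst)
      ((tsupport_radialCutoff_subset hs hst).trans hΩ) (radialCutoff_mem_Icc s t))
    (fun x hx => ?_) (fun x hx => ?_)
  · rcases not_and_or.mp hx with hx | hx
    · rw [truncation, radialCutoff_of_le_norm hs hst (not_lt.mp hx), zero_mul, sub_zero]
    · rw [truncation_of_le (not_lt.mp hx), sub_zero]
  · rw [truncationGradient_of_le (not_lt.mp fun hlu => hx.2 ⟨mem_ball_zero_iff.mp hx.1, hlu⟩),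
      sub_zero]

theorem energy_sub_truncation_superlevel (hA : AssumptionA p lam F) (hp : p ≠ 0)
    (hu : Measurable u) (hl : l ∈ Icc (-1 : ℝ) 1) (hs : 0 ≤ s) (hst : s < t) :
    energy F W (fun x => u x - truncation (radialCutoff s t) l u x)
        (fun x => G x - truncationGradient (radialCutoff s t) l u G x) (superlevel u l s) =
      ∫⁻ x in superlevel u l s, ENNReal.ofReal (W l x) := by
  refine setLIntegral_congr_fun (measurableSet_superlevel hu l s) fun x hx => ?_
  simp [truncation, truncationGradient, radialCutoff_of_norm_le hs hst hx.1.le, hx.2, hx.2.le,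
    gradient_radialCutoff_of_norm_le hs hst hx.1.le, hA.apply_zero hp hl]

theorem setLIntegral_ofReal_ne_top {X : Type*} [MeasurableSpace X] {μ : Measure X} {f : X → ℝ}
    {C : ℝ} {N : Set X} (hf : ∀ x, f x ≤ C) (hN : μ N ≠ ⊤) :
    ∫⁻ x in N, ENNReal.ofReal (f x) ∂μ ≠ ⊤ := by
  refine ((lintegral_mono fun x => ENNReal.ofReal_le_ofReal (hf x)).trans_lt ?_).ne
  rw [setLIntegral_const]
  exact ENNReal.mul_lt_top ENNReal.ofReal_lt_top hN.lt_top

end EnergyComparison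

section Caccioppoli

variable {n : ℕ} {p m lam : ℝ} {F : 𝔼 n → ℝ → 𝔼 n → ℝ} {W : ℝ → 𝔼 n → ℝ} {Ω : Set (𝔼 n)}
  {u : 𝔼 n → ℝ} {G : 𝔼 n → 𝔼 n} {l r s t σ b c ρ : ℝ} {x : 𝔼 n}

/-- The integrand `|∇u|ᵖ + 1_{u > σ}` of the Caccioppoli inequality. -/
noncomputable def caccioppoliDensity (p σ : ℝ) (u : 𝔼 n → ℝ) (G : 𝔼 n → 𝔼 n) (x : 𝔼 n) : ℝ :=
  ‖G x‖ ^ p + if σ < u x then 1 else 0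

theorem caccioppoliDensity_nonneg (p σ : ℝ) (u : 𝔼 n → ℝ) (G : 𝔼 n → 𝔼 n) :
    0 ≤ caccioppoliDensity p σ u G := fun x => by
  unfold caccioppoliDensity
  positivity

theorem measurable_caccioppoliDensity (hu : Measurable u) (hG : Measurable G) :
    Measurable (caccioppoliDensity p σ u G) :=
  (hG.norm.pow_const p).add
    (Measurable.ite (measurableSet_lt measurable_const hu) measurable_const measurable_const)

theorem MemW1pLoc.integrableOn_caccioppoliDensity (h : MemW1pLoc p Ω u G) (hu : Measurable u)
    (hp : 0 < p) (hΩ : Metric.closedBall 0 r ⊆ Ω) :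
    IntegrableOn (caccioppoliDensity p σ u G) (superlevel u l r) := by
  have hsub : superlevel u l r ⊆ Metric.closedBall 0 r :=
    (superlevel_subset_ball u l r).trans Metric.ball_subset_closedBall
  refine ((h.integrableOn_norm_rpow hp (isCompact_closedBall 0 r) hΩ).mono_set hsub).add ?_
  refine Measure.integrableOn_of_bounded (volume_superlevel_ne_top u l r)
    (Measurable.ite (measurableSet_lt measurable_const hu)
      measurable_const measurable_const).aestronglyMeasurable (M := 1) (.of_forall fun x => ?_)
  split_ifs <;> simp

theorem IsMeasurableMinimizer.lintegral_add_le_energy (h : IsMeasurableMinimizer p F W Ω u G)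
    (hA : AssumptionA p lam F) (hB : AssumptionB m lam W) (hC : AssumptionC W) (hlam : 0 < lam)
    (hc : 0 ≤ c) (hc' : c ≤ lam⁻¹) (hl : l ∈ Icc (-1 : ℝ) 1) (hσ : σ ≤ 0)
    (hub : ∀ᵐ x ∂volume.restrict (Metric.ball 0 s), u x ≤ b)
    (hgap : ∀ x τ, σ < τ → τ ≤ b → W l x + c ≤ W τ x) :
    (∫⁻ x in superlevel u l s, ENNReal.ofReal (W l x)) +
        ∫⁻ x in superlevel u l s, ENNReal.ofReal (c * caccioppoliDensity p σ u G x) ≤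
      energy F W u G (superlevel u l s) := by
  rw [← lintegral_add_right _ ((measurable_caccioppoliDensity h.measurable
    h.measurable_gradient).const_mul c).ennreal_ofReal]
  refine lintegral_mono_ae ?_
  filter_upwards [ae_restrict_mem (measurableSet_superlevel h.measurable l s),
    ae_restrict_of_ae_restrict_of_subset (superlevel_subset_ball u l s) hub] with x hx hxb
  rw [← ENNReal.ofReal_add (hB.nonneg hlam hl)
    (mul_nonneg hc (caccioppoliDensity_nonneg p σ u G x))]
  exact ENNReal.ofReal_le_ofReal
    (add_le_integrand hA hC hc' hl.1 hσ (hgap x) hx.2.le (h.mem_Icc x).2 hxb)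

/-- The factor in front of the annulus terms `|∇u|ᵖ + 1_{u > σ} + (t - s)⁻ᵖ` that bound the
excess energy of the competitor. -/
noncomputable def annulusConst (p lam : ℝ) : ℝ :=
  lam * (2 ^ (p - 1) * (2 ^ p + (4 * smoothTransitionLipschitzConst) ^ p))

theorem annulusConst_nonneg (hlam : 0 ≤ lam) : 0 ≤ annulusConst p lam := by
  have := smoothTransitionLipschitzConst_nonneg
  unfold annulusConst
  positivity

theorem norm_sub_truncationGradient_rpow_le (hp : 1 ≤ p) (hs : 0 ≤ s) (hst : s < t)
    (hul : u x - l ≤ 2) :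
    ‖G x - truncationGradient (radialCutoff s t) l u G x‖ ^ p ≤
      2 ^ (p - 1) *
        (2 ^ p * ‖G x‖ ^ p + (4 * smoothTransitionLipschitzConst) ^ p * (t - s)⁻¹ ^ p) := by
  have hL := smoothTransitionLipschitzConst_nonneg
  have hts : 0 ≤ (t - s)⁻¹ := inv_nonneg.mpr (sub_nonneg.mpr hst.le)
  have hnorm : ‖G x - truncationGradient (radialCutoff s t) l u G x‖ ≤
      2 * ‖G x‖ + 4 * smoothTransitionLipschitzConst * (t - s)⁻¹ := by
    linarith [norm_sub_le (G x) (truncationGradient (radialCutoff s t) l u G x),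
      norm_truncationGradient_radialCutoff_le (G := G) hs hst hul]
  rw [← Real.mul_rpow (by norm_num) (norm_nonneg _), ← Real.mul_rpow (by positivity) hts]
  refine (Real.rpow_le_rpow (norm_nonneg _) hnorm (by linarith)).trans ?_
  exact_mod_cast NNReal.rpow_add_le_mul_rpow_add_rpow ⟨2 * ‖G x‖, by positivity⟩
    ⟨4 * smoothTransitionLipschitzConst * (t - s)⁻¹, by positivity⟩ hp

theorem norm_sub_truncationGradient_rpow_add_le (hp : 1 ≤ p) (hlam : 0 ≤ lam) (hs : 0 ≤ s)
    (hst : s < t) (hul : u x - l ≤ 2) :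
    lam * (‖G x - truncationGradient (radialCutoff s t) l u G x‖ ^ p +
        if σ < u x then 1 else 0) ≤
      annulusConst p lam * (caccioppoliDensity p σ u G x + (t - s)⁻¹ ^ p) := by
  have hL := smoothTransitionLipschitzConst_nonneg
  have : 0 ≤ (t - s)⁻¹ := inv_nonneg.mpr (sub_nonneg.mpr hst.le)
  have h := norm_sub_truncationGradient_rpow_le (G := G) hp hs hst hul
  rw [annulusConst, caccioppoliDensity, mul_assoc lam]
  refine mul_le_mul_of_nonneg_left ?_ hlam
  have hi : (0 : ℝ) ≤ if σ < u x then 1 else 0 := by positivity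
  generalize (if σ < u x then (1 : ℝ) else 0) = i at *
  have hL4 : 0 ≤ (4 * smoothTransitionLipschitzConst) ^ p := by positivity
  have h1 : (1 : ℝ) ≤ 2 ^ (p - 1) * (2 ^ p + (4 * smoothTransitionLipschitzConst) ^ p) :=
    one_le_mul_of_one_le_of_one_le (Real.one_le_rpow one_le_two (by linarith))
      ((Real.one_le_rpow one_le_two (by linarith)).trans (le_add_of_nonneg_right hL4))
  have hrest : 0 ≤ 2 ^ (p - 1) *
      ((4 * smoothTransitionLipschitzConst) ^ p * ‖G x‖ ^ p + 2 ^ p * (t - s)⁻¹ ^ p) := by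
    positivity
  linarith [mul_le_mul_of_nonneg_right h1 hi]

theorem IsMeasurableMinimizer.energy_sub_truncation_le (h : IsMeasurableMinimizer p F W Ω u G)
    (hA : AssumptionA p lam F) (hB : AssumptionB m lam W) (hC : AssumptionC W) (hp : 1 ≤ p)
    (hm : 0 ≤ m) (hlam : 0 < lam) (hl : -1 ≤ l) (hσ : σ ≤ 0) (hs : 0 ≤ s) (hst : s < t)
    {N : Set (𝔼 n)} (hN : MeasurableSet N) (hNl : ∀ x ∈ N, l < u x) :
    energy F W (fun x => u x - truncation (radialCutoff s t) l u x)
        (fun x => G x - truncationGradient (radialCutoff s t) l u G x) N ≤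
      (∫⁻ x in N, ENNReal.ofReal (W (u x) x)) + ∫⁻ x in N,
        ENNReal.ofReal (annulusConst p lam * (caccioppoliDensity p σ u G x + (t - s)⁻¹ ^ p)) := by
  have hts : 0 ≤ (t - s)⁻¹ ^ p := Real.rpow_nonneg (inv_nonneg.mpr (sub_nonneg.mpr hst.le)) p
  rw [← lintegral_add_right _ (((measurable_caccioppoliDensity h.measurable
    h.measurable_gradient).add_const _).const_mul _).ennreal_ofReal]
  refine setLIntegral_mono_ae' hN (.of_forall fun x hx => ?_)
  rw [← ENNReal.ofReal_add (hB.nonneg hlam (h.mem_Icc x))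
    (mul_nonneg (annulusConst_nonneg hlam.le)
      (add_nonneg (caccioppoliDensity_nonneg p σ u G x) hts))]
  have hv := sub_truncation_mem_Icc (radialCutoff_mem_Icc s t x) (hNl x hx).le
  exact ENNReal.ofReal_le_ofReal ((integrand_le_add hA hB hC hm hlam hσ (hl.trans hv.1) hv.2
    (h.mem_Icc x).2).trans (add_le_add_right (norm_sub_truncationGradient_rpow_add_le hp hlam.le
      hs hst (by linarith [(h.mem_Icc x).2])) _))

theorem IsMeasurableMinimizer.lintegral_caccioppoliDensity_le
    (h : IsMeasurableMinimizer p F W Ω u G)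
    (hA : AssumptionA p lam F) (hB : AssumptionB m lam W) (hC : AssumptionC W) (hp : 1 ≤ p)
    (hm : 0 ≤ m) (hlam : 0 < lam) (hc : 0 ≤ c) (hc' : c ≤ lam⁻¹)
    (hΩ : Metric.closedBall 0 t ⊆ Ω) (hl : l ∈ Icc (-1 : ℝ) 1) (hσ : σ ≤ 0)
    (hub : ∀ᵐ x ∂volume.restrict (Metric.ball 0 s), u x ≤ b)
    (hgap : ∀ x τ, σ < τ → τ ≤ b → W l x + c ≤ W τ x) (hs : 0 ≤ s) (hst : s < t) :
    ∫⁻ x in superlevel u l s, ENNReal.ofReal (c * caccioppoliDensity p σ u G x) ≤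
      ∫⁻ x in superlevel u l t \ superlevel u l s,
        ENNReal.ofReal (annulusConst p lam * (caccioppoliDensity p σ u G x + (t - s)⁻¹ ^ p)) := by
  set N := superlevel u l t \ superlevel u l s
  have hsm := measurableSet_superlevel h.measurable l s
  have hNm : MeasurableSet N := (measurableSet_superlevel h.measurable l t).diff hsm
  have hsplit : ∀ (v : 𝔼 n → ℝ) (H : 𝔼 n → 𝔼 n), energy F W v H (superlevel u l t) =
      energy F W v H (superlevel u l s) + energy F W v H N := fun v H => by
    have hsub : superlevel u l t ∩ superlevel u l s = superlevel u l s :=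
      inter_eq_self_of_subset_right (superlevel_mono u le_rfl hst.le)
    simpa only [energy, hsub] using (lintegral_inter_add_sdiff (μ := volume)
      (fun x => ENNReal.ofReal (F (H x) (v x) x + W (v x) x)) (superlevel u l t) hsm).symm
  have hcmp := h.energy_superlevel_le hA hB hp hm hlam hΩ hl.1 hs hst
  rw [hsplit, hsplit, energy_sub_truncation_superlevel hA (by linarith) h.measurable hl hs hst]
    at hcmp
  have hinner := h.lintegral_add_le_energy hA hB hC hlam hc hc' hl hσ hub hgap
  have houter : ∫⁻ x in N, ENNReal.ofReal (W (u x) x) ≤ energy F W u G N :=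
    lintegral_mono fun x => ENNReal.ofReal_le_ofReal <| le_add_of_nonneg_left <|
      (by positivity : 0 ≤ lam⁻¹ * ‖G x‖ ^ p).trans (hA _ _ _ (h.mem_Icc x)).1
  have hcomp := h.energy_sub_truncation_le hA hB hC hp hm hlam hl.1 hσ hs hst hNm
    fun x hx => hx.1.2
  have hWl : ∫⁻ x in superlevel u l s, ENNReal.ofReal (W l x) ≠ ⊤ :=
    setLIntegral_ofReal_ne_top (fun x => hB.le hm hlam hl) (volume_superlevel_ne_top u l s)
  have hWu : ∫⁻ x in N, ENNReal.ofReal (W (u x) x) ≠ ⊤ :=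
    setLIntegral_ofReal_ne_top (fun x => hB.le hm hlam (h.mem_Icc x))
      (ne_top_of_le_ne_top (volume_superlevel_ne_top u l t) (measure_mono sdiff_subset))
  have hall := (add_le_add hinner houter).trans (hcmp.trans (add_le_add_right hcomp _))
  rwa [add_assoc, ENNReal.add_le_add_iff_left hWl, add_comm, ENNReal.add_le_add_iff_left hWu]
    at hall

theorem IsMeasurableMinimizer.setIntegral_caccioppoliDensity_le
    (h : IsMeasurableMinimizer p F W Ω u G)
    (hA : AssumptionA p lam F) (hB : AssumptionB m lam W) (hC : AssumptionC W) (hp : 1 ≤ p)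
    (hm : 0 ≤ m) (hlam : 0 < lam) (hc : 0 ≤ c) (hc' : c ≤ lam⁻¹)
    (hΩ : Metric.closedBall 0 t ⊆ Ω) (hl : l ∈ Icc (-1 : ℝ) 1) (hσ : σ ≤ 0)
    (hub : ∀ᵐ x ∂volume.restrict (Metric.ball 0 s), u x ≤ b)
    (hgap : ∀ x τ, σ < τ → τ ≤ b → W l x + c ≤ W τ x) (hs : 0 ≤ s) (hst : s < t) :
    c * ∫ x in superlevel u l s, caccioppoliDensity p σ u G x ≤
      annulusConst p lam * ((∫ x in superlevel u l t, caccioppoliDensity p σ u G x) -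
        (∫ x in superlevel u l s, caccioppoliDensity p σ u G x) +
          (t - s)⁻¹ ^ p * volume.real (superlevel u l t)) := by
  have hts : 0 ≤ (t - s)⁻¹ ^ p := Real.rpow_nonneg (inv_nonneg.mpr (sub_nonneg.mpr hst.le)) p
  have hK := annulusConst_nonneg (p := p) hlam.le
  have hd := caccioppoliDensity_nonneg p σ u G
  have hsm := measurableSet_superlevel h.measurable l s
  have hit := h.memW1pLoc.integrableOn_caccioppoliDensity (σ := σ) (l := l) h.measurable
    (by linarith) hΩ
  have hsub : superlevel u l s ⊆ superlevel u l t := superlevel_mono u le_rfl hst.le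
  have hvol := volume_superlevel_ne_top u l t
  have hvolN := ne_top_of_le_ne_top hvol (measure_mono (sdiff_subset (t := superlevel u l s)))
  have hiN := hit.mono_set (sdiff_subset (t := superlevel u l s))
  have hiA : IntegrableOn
      (fun x => annulusConst p lam * (caccioppoliDensity p σ u G x + (t - s)⁻¹ ^ p))
      (superlevel u l t \ superlevel u l s) :=
    (hiN.add (integrableOn_const hvolN)).const_mul _
  have key := h.lintegral_caccioppoliDensity_le hA hB hC hp hm hlam hc hc' hΩ hl hσ hub hgap hs hst
  rw [← ofReal_integral_eq_lintegral_ofReal ((hit.mono_set hsub).const_mul c)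
      (.of_forall fun x => mul_nonneg hc (hd x)),
    ← ofReal_integral_eq_lintegral_ofReal hiA
      (.of_forall fun x => mul_nonneg hK (add_nonneg (hd x) hts)),
    ENNReal.ofReal_le_ofReal_iff (integral_nonneg fun x => mul_nonneg hK (add_nonneg (hd x) hts)),
    integral_const_mul] at key
  refine key.trans ?_
  rw [integral_const_mul, integral_add hiN (integrableOn_const hvolN), setIntegral_const,
    setIntegral_sdiff hsm hit hsub, smul_eq_mul, mul_comm (volume.real _)]
  gcongr
  exact sdiff_subset

end Caccioppoli

section HoleFilling

variable {n : ℕ} {p m lam θ : ℝ} {F : 𝔼 n → ℝ → 𝔼 n → ℝ} {W : ℝ → 𝔼 n → ℝ} {Ω : Set (𝔼 n)}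
  {u : 𝔼 n → ℝ} {G : 𝔼 n → 𝔼 n} {l s t σ b c ρ A B : ℝ}

theorem le_div_of_forall_le_mul_succ_add {f : ℕ → ℝ} {q : ℝ} (hθ : 0 ≤ θ) (hθ1 : θ < 1)
    (hq : 0 ≤ q) (hθq : θ * q < 1) (hA : 0 ≤ A) (hB : ∀ i, f i ≤ B)
    (hf : ∀ i, f i ≤ θ * f (i + 1) + A * q ^ i) : f 0 ≤ A / (1 - θ * q) := by
  have hpos : 0 < 1 - θ * q := sub_pos.mpr hθq
  set A' := A / (1 - θ * q) with hA'
  have hstep : ∀ i, f i - A' * q ^ i ≤ θ * (f (i + 1) - A' * q ^ (i + 1)) := fun i => by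
    have : A * q ^ i = A' * q ^ i - θ * (A' * q ^ (i + 1)) := by
      rw [hA', pow_succ]
      field_simp
    linarith [hf i]
  have hiter : ∀ i, f 0 - A' ≤ θ ^ i * (f i - A' * q ^ i) := fun i => by
    induction i with
    | zero => simp
    | succ i ih =>
      rw [pow_succ, mul_assoc]
      exact ih.trans (mul_le_mul_of_nonneg_left (hstep i) (pow_nonneg hθ i))
  have hle : ∀ i, f 0 - A' ≤ θ ^ i * B := fun i =>
    (hiter i).trans (mul_le_mul_of_nonneg_left
      ((sub_le_self _ (by positivity)).trans (hB i)) (pow_nonneg hθ i))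
  have hlim := (tendsto_pow_atTop_nhds_zero_of_lt_one hθ hθ1).mul_const B
  rw [zero_mul] at hlim
  exact sub_nonpos.mp (ge_of_tendsto' hlim hle)

theorem le_mul_of_forall_le_mul_add_rpow {f : ℝ → ℝ} {a : ℝ} (hθ : 0 ≤ θ) (hθ1 : θ < 1)
    (ha0 : 0 < a) (ha1 : a < 1) (hθa : θ < a ^ p) (hst : s < t) (hA : 0 ≤ A)
    (hB : ∀ r ≤ t, f r ≤ B)
    (hf : ∀ r r', s ≤ r → r < r' → r' ≤ t → f r ≤ θ * f r' + A * (r' - r)⁻¹ ^ p) :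
    f s ≤ A * ((1 - a)⁻¹ ^ p * (t - s)⁻¹ ^ p) / (1 - θ * a⁻¹ ^ p) := by
  have hd : 0 < t - s := sub_pos.mpr hst
  have h1a : 0 ≤ (1 - a)⁻¹ := inv_nonneg.mpr (by linarith)
  -- The gaps of the radii decay like `a ^ i` with `θ < a ^ p < 1`, so `θ` absorbs their growth.
  set radius : ℕ → ℝ := fun i => t - a ^ i * (t - s) with hradius
  have hgap : ∀ i, radius (i + 1) - radius i = a ^ i * ((1 - a) * (t - s)) := fun i => by
    simp only [hradius, pow_succ]
    ring
  have hle : ∀ i, radius i ≤ t := fun i => sub_le_self t (by positivity)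
  have hge : ∀ i, s ≤ radius i := fun i => by
    have := mul_le_of_le_one_left hd.le (pow_le_one₀ ha0.le ha1.le (n := i))
    simp only [hradius]
    linarith
  have hstep : ∀ i, f (radius i) ≤ θ * f (radius (i + 1)) +
      A * ((1 - a)⁻¹ ^ p * (t - s)⁻¹ ^ p) * (a⁻¹ ^ p) ^ i := fun i => by
    have hlt : radius i < radius (i + 1) := by
      rw [← sub_pos, hgap]
      exact mul_pos (pow_pos ha0 i) (mul_pos (by linarith) hd)
    refine (hf _ _ (hge i) hlt (hle _)).trans_eq ?_
    rw [hgap, mul_inv, mul_inv, ← inv_pow, Real.mul_rpow (by positivity) (by positivity),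
      Real.mul_rpow h1a (by positivity), ← Real.rpow_pow_comm (by positivity)]
    ring
  have hθa' : θ * a⁻¹ ^ p < 1 := by
    rwa [Real.inv_rpow ha0.le, ← div_eq_mul_inv, div_lt_one (by positivity)]
  have h := le_div_of_forall_le_mul_succ_add (f := fun i => f (radius i)) hθ hθ1 (by positivity)
    hθa' (by positivity) (fun i => hB _ (hle i)) hstep
  simpa only [hradius, pow_zero, one_mul, sub_sub_cancel] using h

/-- The constant of the hole-filling lemma `le_holeFillingConst_mul`. -/
noncomputable def holeFillingConst (p θ : ℝ) : ℝ :=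
  (1 - ((1 + θ) / 2) ^ p⁻¹)⁻¹ ^ p / (1 - θ * (((1 + θ) / 2) ^ p⁻¹)⁻¹ ^ p)

theorem rpow_inv_mem_Ioo_and_lt_rpow (hp : 0 < p) (hθ : 0 ≤ θ) (hθ1 : θ < 1) :
    ((1 + θ) / 2) ^ p⁻¹ ∈ Ioo (0 : ℝ) 1 ∧ θ < (((1 + θ) / 2) ^ p⁻¹) ^ p := by
  refine ⟨⟨by positivity, Real.rpow_lt_one (by positivity) (by linarith) (inv_pos.mpr hp)⟩, ?_⟩
  rw [Real.rpow_inv_rpow (by positivity) hp.ne']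
  linarith

theorem holeFillingConst_nonneg (hp : 0 < p) (hθ : 0 ≤ θ) (hθ1 : θ < 1) :
    0 ≤ holeFillingConst p θ := by
  obtain ⟨⟨ha0, ha1⟩, hθa⟩ := rpow_inv_mem_Ioo_and_lt_rpow hp hθ hθ1
  refine div_nonneg (Real.rpow_nonneg (inv_nonneg.mpr (sub_nonneg.mpr ha1.le)) p) ?_
  rw [Real.inv_rpow ha0.le, sub_nonneg, ← div_eq_mul_inv]
  exact div_le_one_of_le₀ hθa.le (by positivity)

theorem le_holeFillingConst_mul {f : ℝ → ℝ} (hp : 0 < p) (hθ : 0 ≤ θ) (hθ1 : θ < 1) (hst : s < t)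
    (hA : 0 ≤ A) (hB : ∀ r ≤ t, f r ≤ B)
    (hf : ∀ r r', s ≤ r → r < r' → r' ≤ t → f r ≤ θ * f r' + A * (r' - r)⁻¹ ^ p) :
    f s ≤ holeFillingConst p θ * (A * (t - s)⁻¹ ^ p) := by
  obtain ⟨⟨ha0, ha1⟩, hθa⟩ := rpow_inv_mem_Ioo_and_lt_rpow hp hθ hθ1
  refine (le_mul_of_forall_le_mul_add_rpow hθ hθ1 ha0 ha1 hθa hst hA hB hf).trans_eq ?_
  rw [holeFillingConst]
  ring

/-- The Caccioppoli inequality for `u` above the level `l`, on balls contained in that of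
radius `ρ`. -/
def SatisfiesCaccioppoli (p K σ : ℝ) (u : 𝔼 n → ℝ) (G : 𝔼 n → 𝔼 n) (l ρ : ℝ) : Prop :=
  ∀ s t, 0 ≤ s → s < t → t < ρ →
    ∫ x in superlevel u l s, caccioppoliDensity p σ u G x ≤
      K * ((t - s)⁻¹ ^ p * volume.real (superlevel u l t))

/-- The fraction `θ < 1` of the energy in a larger ball that is left in the hole-filling step. -/
noncomputable def holeFillingRatio (p lam c : ℝ) : ℝ :=
  annulusConst p lam / (min c lam⁻¹ + annulusConst p lam)

theorem holeFillingRatio_mem_Ico (hlam : 0 < lam) (hc : 0 < c) :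
    holeFillingRatio p lam c ∈ Ico (0 : ℝ) 1 := by
  have hK := annulusConst_nonneg (p := p) hlam.le
  have hk : 0 < min c lam⁻¹ := lt_min hc (inv_pos.mpr hlam)
  exact ⟨by unfold holeFillingRatio; positivity, (div_lt_one (by positivity)).mpr (by linarith)⟩

/-- The constant of the Caccioppoli inequality for minimizers, where `c` is the size of the gap of
the potential. -/
noncomputable def caccioppoliConst (p lam c : ℝ) : ℝ :=
  holeFillingConst p (holeFillingRatio p lam c) * holeFillingRatio p lam c

theorem caccioppoliConst_nonneg (hp : 0 < p) (hlam : 0 < lam) (hc : 0 < c) :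
    0 ≤ caccioppoliConst p lam c := by
  have h := holeFillingRatio_mem_Ico (p := p) hlam hc
  exact mul_nonneg (holeFillingConst_nonneg hp h.1 h.2) h.1

theorem IsMeasurableMinimizer.setIntegral_caccioppoliDensity_le_holeFillingRatio_mul
    (h : IsMeasurableMinimizer p F W Ω u G)
    (hA : AssumptionA p lam F) (hB : AssumptionB m lam W) (hC : AssumptionC W) (hp : 1 ≤ p)
    (hm : 0 ≤ m) (hlam : 0 < lam) (hc : 0 < c) (hΩ : Metric.closedBall 0 t ⊆ Ω)
    (hl : l ∈ Icc (-1 : ℝ) 1) (hσ : σ ≤ 0)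
    (hub : ∀ᵐ x ∂volume.restrict (Metric.ball 0 s), u x ≤ b)
    (hgap : ∀ x τ, σ < τ → τ ≤ b → W l x + c ≤ W τ x) (hs : 0 ≤ s) (hst : s < t) :
    ∫ x in superlevel u l s, caccioppoliDensity p σ u G x ≤
      holeFillingRatio p lam c * ((∫ x in superlevel u l t, caccioppoliDensity p σ u G x) +
        (t - s)⁻¹ ^ p * volume.real (superlevel u l t)) := by
  have hk : 0 < min c lam⁻¹ := lt_min hc (inv_pos.mpr hlam)
  have hpos : 0 < min c lam⁻¹ + annulusConst p lam :=
    add_pos_of_pos_of_nonneg hk (annulusConst_nonneg hlam.le)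
  have key := h.setIntegral_caccioppoliDensity_le hA hB hC hp hm hlam hk.le (min_le_right _ _) hΩ hl
    hσ hub (fun x τ hστ hτb => (add_le_add_right (min_le_left _ _) _).trans (hgap x τ hστ hτb))
    hs hst
  rw [holeFillingRatio, div_mul_eq_mul_div, le_div_iff₀ hpos]
  linarith

theorem IsMeasurableMinimizer.satisfiesCaccioppoli (h : IsMeasurableMinimizer p F W Ω u G)
    (hA : AssumptionA p lam F) (hB : AssumptionB m lam W) (hC : AssumptionC W) (hp : 1 ≤ p)
    (hm : 0 ≤ m) (hlam : 0 < lam) (hc : 0 < c) (hΩ : Metric.ball 0 ρ ⊆ Ω)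
    (hl : l ∈ Icc (-1 : ℝ) 1) (hσ : σ ≤ 0)
    (hub : ∀ᵐ x ∂volume.restrict (Metric.ball 0 ρ), u x ≤ b)
    (hgap : ∀ x τ, σ < τ → τ ≤ b → W l x + c ≤ W τ x) :
    SatisfiesCaccioppoli p (caccioppoliConst p lam c) σ u G l ρ := fun s t hs hst ht => by
  have hθ := holeFillingRatio_mem_Ico (p := p) hlam hc
  have hsubset : ∀ {r}, r ≤ t → Metric.closedBall 0 r ⊆ Ω := fun hr =>
    (Metric.closedBall_subset_ball (hr.trans_lt ht)).trans hΩ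
  have hmono : ∀ r ≤ t, ∫ x in superlevel u l r, caccioppoliDensity p σ u G x ≤
      ∫ x in superlevel u l t, caccioppoliDensity p σ u G x := fun r hr =>
    setIntegral_mono_set (h.memW1pLoc.integrableOn_caccioppoliDensity h.measurable (by linarith)
      (hsubset le_rfl)) (.of_forall (caccioppoliDensity_nonneg p σ u G))
      (superlevel_mono u le_rfl hr).eventuallyLE
  have hfill := le_holeFillingConst_mul (p := p) (f := fun r => ∫ x in superlevel u l r,
    caccioppoliDensity p σ u G x) (by linarith) hθ.1 hθ.2 hst
    (mul_nonneg hθ.1 (measureReal_nonneg (μ := volume) (s := superlevel u l t))) hmono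
    fun r r' hr hrr' hr' => ?_
  · refine hfill.trans_eq ?_
    rw [caccioppoliConst]
    ring
  · have hub' := ae_restrict_of_ae_restrict_of_subset
      (Metric.ball_subset_ball ((hrr'.le.trans hr').trans ht.le)) hub
    have hvol : volume.real (superlevel u l r') ≤ volume.real (superlevel u l t) :=
      measureReal_mono (superlevel_mono u le_rfl hr') (volume_superlevel_ne_top u l t)
    have : 0 ≤ (r' - r)⁻¹ ^ p :=
      Real.rpow_nonneg (inv_nonneg.mpr (sub_nonneg.mpr hrr'.le)) p
    refine (h.setIntegral_caccioppoliDensity_le_holeFillingRatio_mul hA hB hC hp hm hlam hc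
      (hsubset hr') hl hσ hub' hgap (hs.trans hr) hrr').trans ?_
    rw [mul_add, mul_assoc _ (volume.real _), mul_comm (volume.real _)]
    gcongr
    exact hθ.1

end HoleFilling

section DeGiorgiStep

variable {n : ℕ} {p K : ℝ} {Ω : Set (𝔼 n)} {u : 𝔼 n → ℝ} {G : 𝔼 n → 𝔼 n}
  {l l' s t δ σ ρ q : ℝ}

theorem norm_truncationGradient_le_indicator (hp : 1 ≤ p) (hs : 0 ≤ s) (hδ : 0 < δ)
    (hul : ∀ x, u x - l ≤ 2) (σ : ℝ) (x : 𝔼 n) :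
    ‖truncationGradient (radialCutoff s (s + δ)) l u G x‖ ≤
      (superlevel u l (s + δ)).indicator (fun y => δ⁻¹ *
        (1 + 4 * smoothTransitionLipschitzConst + δ ^ p * caccioppoliDensity p σ u G y)) x := by
  have hst : s < s + δ := by linarith
  by_cases hx : x ∈ superlevel u l (s + δ)
  · rw [indicator_of_mem hx]
    have hyoung : δ * ‖G x‖ ≤ 1 + δ ^ p * ‖G x‖ ^ p := by
      rw [← Real.mul_rpow hδ.le (norm_nonneg _)]
      rcases le_total (δ * ‖G x‖) 1 with h | h
      · exact h.trans (le_add_of_nonneg_right (by positivity))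
      · exact (Real.self_le_rpow_of_one_le h hp).trans (le_add_of_nonneg_left zero_le_one)
    have hdensity : ‖G x‖ ^ p ≤ caccioppoliDensity p σ u G x :=
      le_add_of_nonneg_right (by positivity)
    have hG : ‖G x‖ ≤ δ⁻¹ * (1 + δ ^ p * caccioppoliDensity p σ u G x) := by
      rw [le_inv_mul_iff₀ hδ]
      exact hyoung.trans (by gcongr)
    refine (norm_truncationGradient_radialCutoff_le hs hst (hul x)).trans ?_
    rw [add_sub_cancel_left]
    linarith
  · rw [indicator_of_notMem hx, norm_le_zero_iff]
    rcases not_and_or.mp hx with hx | hx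
    · rw [truncationGradient, radialCutoff_of_le_norm hs hst (not_lt.mp hx),
        gradient_radialCutoff_of_le_norm hs hst (not_lt.mp hx), zero_smul, smul_zero, add_zero]
    · exact truncationGradient_of_le (not_lt.mp hx)

theorem integrableOn_mul_add_mul_caccioppoliDensity {r : ℝ}
    (hint : IntegrableOn (caccioppoliDensity p σ u G) (superlevel u l r)) (a b c : ℝ) :
    IntegrableOn (fun x => a * (b + c * caccioppoliDensity p σ u G x)) (superlevel u l r) :=
  ((integrableOn_const (volume_superlevel_ne_top u l r)).add (hint.const_mul c)).const_mul a

theorem integrable_truncationGradient (hum : Measurable u) (hGm : Measurable G) (hp : 1 ≤ p)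
    (hs : 0 ≤ s) (hδ : 0 < δ) (hul : ∀ x, u x - l ≤ 2)
    (hint : IntegrableOn (caccioppoliDensity p σ u G) (superlevel u l (s + δ))) :
    Integrable (truncationGradient (radialCutoff s (s + δ)) l u G) := by
  refine ((integrable_indicator_iff (measurableSet_superlevel hum l _)).mpr
    (integrableOn_mul_add_mul_caccioppoliDensity hint _ _ _)).mono'
      (measurable_truncationGradient (contDiff_radialCutoff.of_le (by exact_mod_cast le_top))
        hum hGm).aestronglyMeasurable
      (.of_forall (norm_truncationGradient_le_indicator hp hs hδ hul σ))

theorem integral_norm_truncationGradient_radialCutoff_le (hum : Measurable u) (hGm : Measurable G)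
    (hp : 1 ≤ p) (hs : 0 ≤ s) (hδ : 0 < δ) (hul : ∀ x, u x - l ≤ 2)
    (hint : IntegrableOn (caccioppoliDensity p σ u G) (superlevel u l (s + δ))) :
    ∫ x, ‖truncationGradient (radialCutoff s (s + δ)) l u G x‖ ≤
      δ⁻¹ * ((1 + 4 * smoothTransitionLipschitzConst) * volume.real (superlevel u l (s + δ)) +
        δ ^ p * ∫ x in superlevel u l (s + δ), caccioppoliDensity p σ u G x) := by
  have hmeas := measurableSet_superlevel hum l (s + δ)
  have hconst : Integrable (fun _ => 1 + 4 * smoothTransitionLipschitzConst)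
      (volume.restrict (superlevel u l (s + δ))) :=
    integrableOn_const (volume_superlevel_ne_top u l (s + δ))
  refine (integral_mono (integrable_truncationGradient hum hGm hp hs hδ hul hint).norm
    ((integrable_indicator_iff hmeas).mpr (integrableOn_mul_add_mul_caccioppoliDensity hint _ _ _))
    (norm_truncationGradient_le_indicator hp hs hδ hul σ)).trans_eq ?_
  rw [integral_indicator hmeas, integral_const_mul,
    integral_add hconst (hint.const_mul _), integral_const_mul, setIntegral_const, smul_eq_mul,
    mul_comm (volume.real _)]

theorem SatisfiesCaccioppoli.integral_norm_truncationGradient_le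
    (hK : SatisfiesCaccioppoli p K σ u G l ρ) (hum : Measurable u) (hGm : Measurable G)
    (hp : 1 ≤ p) (hs : 0 ≤ s) (hδ : 0 < δ) (hρ : s + 2 * δ < ρ) (hul : ∀ x, u x - l ≤ 2)
    (hint : IntegrableOn (caccioppoliDensity p σ u G) (superlevel u l (s + δ))) :
    ∫ x, ‖truncationGradient (radialCutoff s (s + δ)) l u G x‖ ≤
      (1 + 4 * smoothTransitionLipschitzConst + K) *
        (δ⁻¹ * volume.real (superlevel u l (s + 2 * δ))) := by
  have hL := smoothTransitionLipschitzConst_nonneg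
  have hvol : volume.real (superlevel u l (s + δ)) ≤ volume.real (superlevel u l (s + 2 * δ)) :=
    measureReal_mono (superlevel_mono u le_rfl (by linarith)) (volume_superlevel_ne_top u l _)
  have hcacc := hK (s + δ) (s + 2 * δ) (by positivity) (by linarith) hρ
  rw [show s + 2 * δ - (s + δ) = δ by ring] at hcacc
  refine (integral_norm_truncationGradient_radialCutoff_le hum hGm hp hs hδ hul hint).trans ?_
  calc δ⁻¹ * ((1 + 4 * smoothTransitionLipschitzConst) * volume.real (superlevel u l (s + δ)) +
        δ ^ p * ∫ x in superlevel u l (s + δ), caccioppoliDensity p σ u G x)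
      ≤ δ⁻¹ * ((1 + 4 * smoothTransitionLipschitzConst) * volume.real (superlevel u l (s + 2 * δ)) +
        δ ^ p * (K * (δ⁻¹ ^ p * volume.real (superlevel u l (s + 2 * δ))))) := by gcongr
    _ = _ := by
      rw [Real.inv_rpow hδ.le]
      have : δ ^ p ≠ 0 := by positivity
      field_simp

theorem rpow_mul_volume_superlevel_le_lintegral (hum : Measurable u) (hs : 0 ≤ s) (hst : s < t)
    (hl : l < l') (hq : 0 ≤ q) :
    ENNReal.ofReal ((l' - l) ^ q) * volume (superlevel u l' s) ≤
      ∫⁻ x, ‖truncation (radialCutoff s t) l u x‖ₑ ^ q := by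
  rw [← setLIntegral_const]
  refine (setLIntegral_mono' (measurableSet_superlevel hum l' s) fun x hx => ?_).trans
    (setLIntegral_le_lintegral _ _)
  rw [← ENNReal.ofReal_rpow_of_pos (sub_pos.mpr hl), ← ofReal_norm]
  gcongr
  rw [truncation, radialCutoff_of_norm_le hs hst hx.1.le, one_mul]
  exact (sub_le_sub_right hx.2.le l).trans ((le_max_left _ _).trans (le_abs_self _))

theorem integrable_truncation (hum : Measurable u) (hs : 0 ≤ s) (hst : s < t)
    (hul : ∀ x, u x - l ≤ 2) : Integrable (truncation (radialCutoff s t) l u) := by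
  have hsupport : HasCompactSupport (truncation (radialCutoff s t) l u) :=
    (hasCompactSupport_radialCutoff hs hst).mul_right
  rw [← integrableOn_iff_integrable_of_support_subset (subset_tsupport _)]
  refine Measure.integrableOn_of_bounded (M := 2) hsupport.isCompact.measure_ne_top
    (measurable_truncation contDiff_radialCutoff.continuous.measurable hum).aestronglyMeasurable
    (.of_forall fun x => ?_)
  have hη := radialCutoff_mem_Icc s t x
  rw [truncation, Real.norm_of_nonneg (mul_nonneg hη.1 (le_max_right _ _))]
  exact (mul_le_of_le_one_left (le_max_right _ _) hη.2).trans (max_le (hul x) zero_le_two)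

theorem MemW1pLoc.rpow_mul_volume_superlevel_le (hu : MemW1pLoc p Ω u G) (hn : 2 ≤ n) (hp : 1 ≤ p)
    (hΩ : IsOpen Ω) (hum : Measurable u) (hs : 0 ≤ s) (hst : s < t)
    (ht : Metric.closedBall 0 t ⊆ Ω) (hul : ∀ x, u x - l ≤ 2) (hl : l < l')
    (hint : Integrable (truncationGradient (radialCutoff s t) l u G)) :
    (l' - l) ^ ((n : ℝ) / (n - 1)) * volume.real (superlevel u l' s) ≤
      lintegralPowLePowLIntegralFDerivConst (volume : Measure (𝔼 n)) (n / (n - 1)) *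
        (∫ x, ‖truncationGradient (radialCutoff s t) l u G x‖) ^ ((n : ℝ) / (n - 1)) := by
  have hn1 : (1 : ℝ) < n := by exact_mod_cast hn
  have hq : 0 ≤ (n : ℝ) / (n - 1) := div_nonneg (by linarith) (by linarith)
  have hδ : 0 ≤ (l' - l) ^ ((n : ℝ) / (n - 1)) := Real.rpow_nonneg (sub_nonneg.mpr hl.le) _
  have hsobolev := (rpow_mul_volume_superlevel_le_lintegral hum hs hst hl hq).trans
    ((hu.truncation hp hΩ hum contDiff_radialCutoff (hasCompactSupport_radialCutoff hs hst)
      ((tsupport_radialCutoff_subset hs hst).trans ht)).isWeakGradient.lintegral_rpow_le hn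
      (integrable_truncation hum hs hst hul) hint (hasCompactSupport_radialCutoff hs hst).mul_right)
  rw [← ofReal_integral_norm_eq_lintegral_enorm hint,
    ENNReal.ofReal_rpow_of_nonneg (integral_nonneg fun _ => norm_nonneg _) hq] at hsobolev
  have hreal := ENNReal.toReal_mono (by finiteness) hsobolev
  rwa [ENNReal.toReal_mul, ENNReal.toReal_mul, ENNReal.toReal_ofReal hδ,
    ENNReal.toReal_ofReal (by positivity)] at hreal

/-- The constant of the De Giorgi step `SatisfiesCaccioppoli.volume_superlevel_le`. -/
noncomputable def deGiorgiConst (n : ℕ) (K : ℝ) : ℝ :=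
  (lintegralPowLePowLIntegralFDerivConst (volume : Measure (𝔼 n)) (n / (n - 1)) : ℝ) ^
    ((n : ℝ) / (n - 1))⁻¹ * (2 * (1 + 4 * smoothTransitionLipschitzConst + K))

theorem deGiorgiConst_nonneg (n : ℕ) (hK : 0 ≤ K) : 0 ≤ deGiorgiConst n K := by
  have := smoothTransitionLipschitzConst_nonneg
  unfold deGiorgiConst
  positivity

theorem SatisfiesCaccioppoli.volume_superlevel_le (hK : SatisfiesCaccioppoli p K σ u G l ρ)
    (hn : 2 ≤ n) (hp : 1 ≤ p) (hK0 : 0 ≤ K) (hΩ : IsOpen Ω) (hρ : Metric.ball 0 ρ ⊆ Ω)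
    (hum : Measurable u) (hGm : Measurable G) (hu : MemW1pLoc p Ω u G) (hul : ∀ x, u x - l ≤ 2)
    (hl : l < l') (hs : 0 ≤ s) (hst : s < t) (ht : t < ρ) :
    volume.real (superlevel u l' s) ≤
      (deGiorgiConst n K * (volume.real (superlevel u l t) / ((t - s) * (l' - l)))) ^
        ((n : ℝ) / (n - 1)) := by
  have hn1 : (1 : ℝ) < n := by exact_mod_cast hn
  have hq : 0 < (n : ℝ) / (n - 1) := div_pos (by linarith) (by linarith)
  have hL := smoothTransitionLipschitzConst_nonneg
  obtain ⟨δ, rfl⟩ : ∃ δ, t = s + 2 * δ := ⟨(t - s) / 2, by ring⟩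
  have hδ : 0 < δ := by linarith
  have hδl : 0 < l' - l := sub_pos.mpr hl
  have hsub : Metric.closedBall 0 (s + δ) ⊆ Ω :=
    (Metric.closedBall_subset_ball (by linarith)).trans hρ
  have hint := hu.integrableOn_caccioppoliDensity (σ := σ) (l := l) hum (by linarith) hsub
  have hsobolev := hu.rpow_mul_volume_superlevel_le hn hp hΩ hum hs (by linarith) hsub hul hl
    (integrable_truncationGradient hum hGm hp hs hδ hul hint)
  have hgrad := hK.integral_norm_truncationGradient_le hum hGm hp hs hδ ht hul hint
  have hdiv : deGiorgiConst n K * (volume.real (superlevel u l (s + 2 * δ)) /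
      ((s + 2 * δ - s) * (l' - l))) =
      (lintegralPowLePowLIntegralFDerivConst (volume : Measure (𝔼 n)) (n / (n - 1)) : ℝ) ^
        ((n : ℝ) / (n - 1))⁻¹ * ((1 + 4 * smoothTransitionLipschitzConst + K) *
          (δ⁻¹ * volume.real (superlevel u l (s + 2 * δ)))) / (l' - l) := by
    rw [deGiorgiConst, add_sub_cancel_left]
    field_simp
  rw [hdiv, Real.div_rpow (by positivity) hδl.le, Real.mul_rpow (by positivity) (by positivity),
    Real.rpow_inv_rpow (by positivity) hq.ne', le_div_iff₀ (by positivity), mul_comm]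
  refine hsobolev.trans ?_
  gcongr

end DeGiorgiStep

section Iteration

theorem tendsto_zero_of_le_mul_pow_mul_rpow {B b q : ℝ} (hB : 0 ≤ B) (hb : 1 < b) (hq : 1 < q)
    {a : ℕ → ℝ} (ha : ∀ j, 0 ≤ a j) (hstep : ∀ j, a (j + 1) ≤ (B * b ^ j * a j) ^ q)
    (h0 : B ^ q * a 0 ^ (q - 1) ≤ (b ^ q)⁻¹ ^ (q - 1)⁻¹) : Tendsto a atTop (𝓝 0) := by
  have hq1 : 0 < q - 1 := by linarith
  have hq0 : 0 < q := by linarith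
  set μ : ℝ := (b ^ q)⁻¹ ^ (q - 1)⁻¹ with hμ
  have hμ0 : 0 < μ := by positivity
  have hμ1 : μ < 1 := Real.rpow_lt_one (by positivity)
    (inv_lt_one_of_one_lt₀ (Real.one_lt_rpow hb hq0)) (inv_pos.mpr hq1)
  have hsplit : ∀ x : ℝ, 0 ≤ x → x ^ q = x ^ (q - 1) * x := fun x hx => by
    rw [← Real.rpow_add_one' hx (by linarith), sub_add_cancel]
  have hbμ : (b * μ) ^ q = μ := by
    rw [Real.mul_rpow (by linarith) hμ0.le, hsplit μ hμ0.le, hμ,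
      Real.rpow_inv_rpow (by positivity) hq1.ne', ← mul_assoc, mul_inv_cancel₀ (by positivity),
      one_mul]
  have hdecay : ∀ j, a j ≤ a 0 * μ ^ j := fun j => by
    induction j with
    | zero => simp
    | succ j ih =>
      calc a (j + 1) ≤ (B * b ^ j * (a 0 * μ ^ j)) ^ q := by
            refine (hstep j).trans ?_
            have := ha j
            gcongr
        _ = (B * a 0) ^ q * μ ^ j := by
            rw [show B * b ^ j * (a 0 * μ ^ j) = B * a 0 * (b * μ) ^ j by rw [mul_pow]; ring,
              Real.mul_rpow (mul_nonneg hB (ha 0)) (by positivity),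
              ← Real.rpow_pow_comm (by positivity), hbμ]
        _ = B ^ q * a 0 ^ (q - 1) * (a 0 * μ ^ j) := by
            rw [Real.mul_rpow hB (ha 0), hsplit _ (ha 0)]
            ring
        _ ≤ μ * (a 0 * μ ^ j) := mul_le_mul_of_nonneg_right h0 (mul_nonneg (ha 0) (by positivity))
        _ = a 0 * μ ^ (j + 1) := by ring
  refine squeeze_zero ha hdecay ?_
  simpa using (tendsto_pow_atTop_nhds_zero_of_lt_one hμ0.le hμ1).const_mul (a 0)

theorem eq_zero_of_le_mul_div_rpow {φ : ℝ → ℝ → ℝ} {C q k d R : ℝ} (hC : 0 ≤ C) (hq : 1 < q)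
    (hd : 0 < d) (hR : 0 < R) (hφ : ∀ l r, 0 ≤ φ l r)
    (hmono : ∀ l l' r r', l ≤ l' → r' ≤ r → φ l' r' ≤ φ l r)
    (hstep : ∀ l l' s t, k ≤ l → l < l' → l' ≤ k + d → R ≤ s → s < t → t ≤ 2 * R →
      φ l' s ≤ (C * (φ l t / ((t - s) * (l' - l)))) ^ q)
    (h0 : (4 * C / (R * d)) ^ q * φ k (2 * R) ^ (q - 1) ≤ (4 ^ q)⁻¹ ^ (q - 1)⁻¹) :
    φ (k + d) R = 0 := by
  set level : ℕ → ℝ := fun j => k + d * (1 - (1 / 2) ^ j) with hlevel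
  set radius : ℕ → ℝ := fun j => R * (1 + (1 / 2) ^ j) with hradius
  have hpow : ∀ j : ℕ, 0 < (1 / 2 : ℝ) ^ j ∧ (1 / 2 : ℝ) ^ j ≤ 1 := fun j =>
    ⟨by positivity, pow_le_one₀ (by norm_num) (by norm_num)⟩
  have hlevel_sub : ∀ j, level (j + 1) - level j = d * (1 / 2) ^ (j + 1) := fun j => by
    simp only [hlevel, pow_succ]
    ring
  have hradius_sub : ∀ j, radius j - radius (j + 1) = R * (1 / 2) ^ (j + 1) := fun j => by
    simp only [hradius, pow_succ]
    ring
  have hlevel_le : ∀ j, level j ≤ k + d := fun j => by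
    simp only [hlevel]
    nlinarith [hpow j]
  have hle_radius : ∀ j, R ≤ radius j := fun j => by
    simp only [hradius]
    nlinarith [hpow j]
  have hlim : Tendsto (fun j => φ (level j) (radius j)) atTop (𝓝 0) := by
    refine tendsto_zero_of_le_mul_pow_mul_rpow (B := 4 * C / (R * d)) (b := 4) (by positivity)
      (by norm_num) hq (fun j => hφ _ _) (fun j => ?_)
      (by simpa [hlevel, hradius, one_add_one_eq_two, mul_comm R] using h0)
    refine (hstep (level j) (level (j + 1)) (radius (j + 1)) (radius j) ?_ ?_ (hlevel_le _)
      (hle_radius _) ?_ ?_).trans_eq ?_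
    · simp only [hlevel]
      nlinarith [hpow j]
    · rw [← sub_pos, hlevel_sub]
      positivity
    · rw [← sub_pos, hradius_sub]
      positivity
    · simp only [hradius]
      nlinarith [hpow j]
    · have h4 : (4 : ℝ) ^ j = ((1 / 2 : ℝ) ^ j * (1 / 2 : ℝ) ^ j)⁻¹ := by
        rw [← mul_pow, ← inv_pow]
        norm_num
      rw [hlevel_sub, hradius_sub, h4, pow_succ]
      have := (hpow j).1
      congr 1
      field_simp
      norm_num
  exact le_antisymm (ge_of_tendsto' hlim fun j => hmono _ _ _ _ (hlevel_le j) (hle_radius j))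
    (hφ _ _)

end Iteration

section Well

variable {n : ℕ} {m lam τ α β κ c δ : ℝ} {W : ℝ → 𝔼 n → ℝ}

theorem AssumptionB.apply_le_mul_rpow (hB : AssumptionB m lam W) (hm : 0 ≤ m) (hlam : 0 ≤ lam)
    (hκ : κ ≤ 2) (hτ : -1 ≤ τ) (hτκ : τ ≤ -1 + κ) (x : 𝔼 n) : W τ x ≤ lam * (2 * κ) ^ m := by
  refine (hB τ x ⟨hτ, by linarith⟩).2.trans (mul_le_mul_of_nonneg_left ?_ hlam)
  exact Real.rpow_le_rpow (by nlinarith) (by nlinarith) hm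

theorem AssumptionB.mul_rpow_le_apply (hB : AssumptionB m lam W) (hm : 0 ≤ m) (hlam : 0 ≤ lam)
    (hα : 0 ≤ α) (hβ : 0 ≤ β) (hτα : -1 + α ≤ τ) (hτβ : τ ≤ 1 - β) (x : 𝔼 n) :
    lam⁻¹ * (α * β) ^ m ≤ W τ x := by
  refine le_trans (mul_le_mul_of_nonneg_left ?_ (inv_nonneg.mpr hlam))
    (hB τ x ⟨by linarith, by linarith⟩).1
  refine Real.rpow_le_rpow (by positivity) ?_ hm
  calc α * β ≤ (1 + τ) * (1 - τ) :=
        mul_le_mul (by linarith) (by linarith) hβ (by linarith)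
    _ = 1 - τ ^ 2 := by ring

theorem exists_mem_Ioo_mul_rpow_le (hm : 0 < m) (lam : ℝ) (hc : 0 < c) (hδ : 0 < δ) :
    ∃ κ ∈ Ioo 0 δ, lam * (2 * κ) ^ m ≤ c := by
  have hlim : Tendsto (fun κ : ℝ => lam * (2 * κ) ^ m) (𝓝[>] 0) (𝓝 (lam * (2 * 0) ^ m)) :=
    ((continuous_const.mul ((continuous_const.mul continuous_id).rpow_const
      fun _ => Or.inr hm.le)).tendsto 0).mono_left nhdsWithin_le_nhds
  rw [mul_zero, Real.zero_rpow hm.ne', mul_zero] at hlim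
  obtain ⟨κ, hκc, hκ⟩ := ((hlim.eventually (ge_mem_nhds hc)).and (Ioo_mem_nhdsGT hδ)).exists
  exact ⟨κ, hκ, hκc⟩

end Well

section LevelSets

variable {n : ℕ} {p K : ℝ} {Ω : Set (𝔼 n)} {u : 𝔼 n → ℝ} {G : 𝔼 n → 𝔼 n} {l k d r R σ ρ : ℝ}

theorem volume_superlevel_le_setIntegral_caccioppoliDensity (hum : Measurable u) (hl : l ≤ σ)
    (hint : IntegrableOn (caccioppoliDensity p σ u G) (superlevel u l r)) :
    volume.real (superlevel u σ r) ≤ ∫ x in superlevel u l r, caccioppoliDensity p σ u G x := by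
  have hsub : superlevel u σ r ⊆ superlevel u l r := superlevel_mono u hl le_rfl
  calc volume.real (superlevel u σ r) = ∫ _ in superlevel u σ r, (1 : ℝ) := by simp
    _ ≤ ∫ x in superlevel u σ r, caccioppoliDensity p σ u G x :=
        setIntegral_mono_on (integrableOn_const (volume_superlevel_ne_top u σ r))
          (hint.mono_set hsub) (measurableSet_superlevel hum σ r) fun x hx => by
            rw [caccioppoliDensity, if_pos hx.2]
            exact le_add_of_nonneg_left (by positivity)
    _ ≤ ∫ x in superlevel u l r, caccioppoliDensity p σ u G x :=
        setIntegral_mono_set hint (.of_forall (caccioppoliDensity_nonneg p σ u G)) hsub.eventuallyLE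

/-- The constant of the bound `SatisfiesCaccioppoli.volume_superlevel_le_pow`. -/
noncomputable def levelSetConst (n : ℕ) (K : ℝ) : ℝ :=
  2 * K * ((5 / 2) ^ n * volume.real (Metric.ball (0 : 𝔼 n) 1))

theorem levelSetConst_nonneg (n : ℕ) (hK : 0 ≤ K) : 0 ≤ levelSetConst n K := by
  unfold levelSetConst
  positivity

theorem SatisfiesCaccioppoli.volume_superlevel_le_pow (hK : SatisfiesCaccioppoli p K σ u G l ρ)
    (hn : n ≠ 0) (hp : 1 ≤ p) (hK0 : 0 ≤ K) (hum : Measurable u) (hl : l ≤ σ) (hR : 2 ≤ R)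
    (hRρ : 5 / 2 * R < ρ)
    (hint : IntegrableOn (caccioppoliDensity p σ u G) (superlevel u l (2 * R))) :
    volume.real (superlevel u σ (2 * R)) ≤ levelSetConst n K * R ^ (n - 1) := by
  have hR0 : 0 < R := by linarith
  have hball : volume.real (superlevel u l (5 / 2 * R)) ≤
      (5 / 2 * R) ^ n * volume.real (Metric.ball (0 : 𝔼 n) 1) := by
    refine (measureReal_mono ((superlevel_subset_ball u _ _).trans Metric.ball_subset_closedBall)
      measure_closedBall_lt_top.ne).trans_eq ?_
    rw [Measure.addHaar_real_closedBall _ _ (by positivity), finrank_euclideanSpace_fin]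
  have hgap : (5 / 2 * R - 2 * R)⁻¹ ^ p ≤ 2 / R := by
    rw [show 5 / 2 * R - 2 * R = R / 2 by ring, inv_div]
    exact Real.rpow_le_self_of_le_one (by positivity) (by rwa [div_le_one hR0]) hp
  calc volume.real (superlevel u σ (2 * R))
      ≤ ∫ x in superlevel u l (2 * R), caccioppoliDensity p σ u G x :=
        volume_superlevel_le_setIntegral_caccioppoliDensity hum hl hint
    _ ≤ K * ((5 / 2 * R - 2 * R)⁻¹ ^ p * volume.real (superlevel u l (5 / 2 * R))) :=
        hK _ _ (by positivity) (by linarith) hRρ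
    _ ≤ K * (2 / R * ((5 / 2 * R) ^ n * volume.real (Metric.ball (0 : 𝔼 n) 1))) := by gcongr
    _ = levelSetConst n K * R ^ (n - 1) := by
        rw [levelSetConst, mul_pow, ← mul_pow_sub_one hn R]
        field_simp

theorem ae_le_of_volume_superlevel_eq_zero (h : volume.real (superlevel u l r) = 0) :
    ∀ᵐ x ∂volume.restrict (Metric.ball 0 r), u x ≤ l := by
  rw [measureReal_eq_zero_iff (volume_superlevel_ne_top u l r)] at h
  rw [ae_restrict_iff' measurableSet_ball, ae_iff]
  refine measure_mono_null (fun x hx => ?_) h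
  simpa only [mem_ofPred_eq, Classical.not_imp, not_le, mem_ball_zero_iff, superlevel] using hx

theorem MemW1pLoc.ae_le_of_forall_satisfiesCaccioppoli (hu : MemW1pLoc p Ω u G) (hn : 2 ≤ n)
    (hp : 1 ≤ p) (hK0 : 0 ≤ K) (hΩ : IsOpen Ω) (hρ : Metric.ball 0 ρ ⊆ Ω) (hum : Measurable u)
    (hGm : Measurable G) (huk : ∀ x, u x - k ≤ 2) (hd : 0 < d) (hR : 0 < R) (hRρ : 2 * R < ρ)
    (hK : ∀ l ∈ Icc k (k + d), SatisfiesCaccioppoli p K σ u G l ρ)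
    (h0 : (4 * deGiorgiConst n K / (R * d)) ^ ((n : ℝ) / (n - 1)) *
        volume.real (superlevel u k (2 * R)) ^ ((n : ℝ) / (n - 1) - 1) ≤
      (4 ^ ((n : ℝ) / (n - 1)))⁻¹ ^ ((n : ℝ) / (n - 1) - 1)⁻¹) :
    ∀ᵐ x ∂volume.restrict (Metric.ball 0 R), u x ≤ k + d := by
  have hn1 : (1 : ℝ) < n := by exact_mod_cast hn
  have hq : 1 < (n : ℝ) / (n - 1) := by
    rw [one_lt_div (by linarith)]
    linarith
  refine ae_le_of_volume_superlevel_eq_zero (eq_zero_of_le_mul_div_rpow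
    (φ := fun l r => volume.real (superlevel u l r)) (deGiorgiConst_nonneg n hK0) hq hd hR
    (fun _ _ => measureReal_nonneg)
    (fun l l' r r' hl hr => measureReal_mono (superlevel_mono u hl hr)
      (volume_superlevel_ne_top u l r))
    (fun l l' s t hl hll' hl' hs hst ht => ?_) h0)
  exact (hK l ⟨hl, hll'.le.trans hl'⟩).volume_superlevel_le hn hp hK0 hΩ hρ hum hGm hu
    (fun x => by linarith [huk x]) hll' (hR.le.trans hs) hst (ht.trans_lt hRρ)

theorem exists_two_le_forall_rpow_mul_rpow_le {C M μ : ℝ} (hn : 2 ≤ n) (hC : 0 ≤ C) (hM : 0 ≤ M)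
    (hd : 0 < d) (hμ : 0 < μ) :
    ∃ R, 2 ≤ R ∧ ∀ V, 0 ≤ V → V ≤ M * R ^ (n - 1) →
      (4 * C / (R * d)) ^ ((n : ℝ) / (n - 1)) * V ^ ((n : ℝ) / (n - 1) - 1) ≤ μ := by
  have hn1 : (0 : ℝ) < n - 1 := sub_pos.mpr (by exact_mod_cast hn)
  have hq : (n : ℝ) / (n - 1) = 1 + (n - 1 : ℝ)⁻¹ := by
    field_simp
    ring
  rw [hq, add_sub_cancel_left]
  set e := (n - 1 : ℝ)⁻¹ with he
  have he0 : 0 < e := inv_pos.mpr hn1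
  have hlim := (tendsto_rpow_neg_atTop he0).const_mul ((4 * C / d) ^ (1 + e) * M ^ e)
  rw [mul_zero] at hlim
  obtain ⟨R, hRμ, hR⟩ := ((hlim.eventually (ge_mem_nhds hμ)).and (eventually_ge_atTop 2)).exists
  have hR0 : 0 < R := by linarith
  refine ⟨R, hR, fun V hV hVM => ?_⟩
  have hRe : (R ^ (n - 1)) ^ e = R := by
    rw [he, ← Nat.cast_pred (by omega), Real.pow_rpow_inv_natCast hR0.le (by omega)]
  calc (4 * C / (R * d)) ^ (1 + e) * V ^ e
      ≤ (4 * C / (R * d)) ^ (1 + e) * (M * R ^ (n - 1)) ^ e := by gcongr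
    _ = (4 * C / d) ^ (1 + e) * M ^ e * R ^ (-e) := by
        rw [Real.mul_rpow hM (by positivity), hRe, mul_comm R d, ← div_div,
          Real.div_rpow (by positivity) hR0.le, Real.rpow_add hR0, Real.rpow_one,
          Real.rpow_neg hR0.le]
        field_simp
    _ ≤ μ := hRμ

end LevelSets

section Minimizers

variable {n : ℕ} {p m lam h κ : ℝ} {F : 𝔼 n → ℝ → 𝔼 n → ℝ} {W : ℝ → 𝔼 n → ℝ} {Ω : Set (𝔼 n)}
  {u : 𝔼 n → ℝ} {G : 𝔼 n → 𝔼 n} {R ρ : ℝ}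

theorem IsMeasurableMinimizer.satisfiesCaccioppoli_neg_one
    (hmin : IsMeasurableMinimizer p F W Ω u G) (hA : AssumptionA p lam F)
    (hB : AssumptionB m lam W) (hC : AssumptionC W) (hp : 1 ≤ p) (hm : 0 < m) (hlam : 0 < lam)
    (hh : 0 < h) (hκ : κ ∈ Ioo (0 : ℝ) 1) (hΩ : Metric.ball 0 ρ ⊆ Ω)
    (hub : ∀ᵐ x ∂volume.restrict (Metric.ball 0 ρ), u x ≤ 1 - h) :
    SatisfiesCaccioppoli p (caccioppoliConst p lam (lam⁻¹ * (κ / 2 * h) ^ m)) (-1 + κ / 2) u G (-1)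
      ρ := by
  have hκ0 := hκ.1
  refine hmin.satisfiesCaccioppoli hA hB hC hp hm.le hlam (by positivity) hΩ (by norm_num)
    (by linarith [hκ.2]) hub fun x τ hτ hτh => ?_
  have hwell := hB.apply_le_mul_rpow hm.le hlam.le (κ := 0) (by norm_num) le_rfl (by norm_num) x
  rw [mul_zero, Real.zero_rpow hm.ne', mul_zero] at hwell
  linarith [hB.mul_rpow_le_apply hm.le hlam.le (by positivity) hh.le hτ.le hτh x]

theorem IsMeasurableMinimizer.satisfiesCaccioppoli_of_mem_Icc
    (hmin : IsMeasurableMinimizer p F W Ω u G) (hA : AssumptionA p lam F)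
    (hB : AssumptionB m lam W) (hC : AssumptionC W) (hp : 1 ≤ p) (hm : 0 ≤ m) (hlam : 0 < lam)
    (hh : 0 < h) (hκ : κ ≤ 1) (hκh : lam * (2 * κ) ^ m ≤ lam⁻¹ * h ^ m / 2)
    (hΩ : Metric.ball 0 ρ ⊆ Ω) (hub : ∀ᵐ x ∂volume.restrict (Metric.ball 0 ρ), u x ≤ 1 - h)
    {l : ℝ} (hl : l ∈ Icc (-1) (-1 + κ)) :
    SatisfiesCaccioppoli p (caccioppoliConst p lam (lam⁻¹ * h ^ m / 2)) 0 u G l ρ := by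
  refine hmin.satisfiesCaccioppoli hA hB hC hp hm hlam (by positivity) hΩ
    ⟨hl.1, by linarith [hl.2]⟩ le_rfl hub fun x τ hτ hτh => ?_
  have hwell := hB.apply_le_mul_rpow hm hlam.le (hκ.trans one_le_two) hl.1 hl.2 x
  have hbarrier := hB.mul_rpow_le_apply hm hlam.le zero_le_one hh.le (by linarith) hτh x
  rw [one_mul] at hbarrier
  linarith

theorem exists_radius_forall_ae_le (hn : 2 ≤ n) (hp : 1 ≤ p) (hm : 0 < m) (hlam : 0 < lam)
    (hh : 0 < h) {δ : ℝ} (hδ : 0 < δ) :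
    ∃ R : ℝ, 0 < R ∧ ∀ (F : 𝔼 n → ℝ → 𝔼 n → ℝ) (W : ℝ → 𝔼 n → ℝ) (Ω : Set (𝔼 n)) (u : 𝔼 n → ℝ)
      (G : 𝔼 n → 𝔼 n), IsMeasurableMinimizer p F W Ω u G → AssumptionA p lam F →
        AssumptionB m lam W → AssumptionC W → Metric.ball 0 (3 * R) ⊆ Ω →
        (∀ᵐ x ∂volume.restrict (Metric.ball 0 (3 * R)), u x ≤ 1 - h) →
        ∀ᵐ x ∂volume.restrict (Metric.ball 0 R), u x ≤ -1 + δ := by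
  obtain ⟨κ, hκ, hκh⟩ := exists_mem_Ioo_mul_rpow_le hm lam
    (by positivity : 0 < lam⁻¹ * h ^ m / 2) (lt_min one_pos hδ)
  have hκ0 := hκ.1
  have hκ1 : κ < 1 := hκ.2.trans_le (min_le_left _ _)
  have hκδ : κ < δ := hκ.2.trans_le (min_le_right _ _)
  have hp0 : 0 < p := by linarith
  have hK₁ := caccioppoliConst_nonneg hp0 hlam (by positivity : 0 < lam⁻¹ * (κ / 2 * h) ^ m)
  have hK₂ := caccioppoliConst_nonneg hp0 hlam (by positivity : 0 < lam⁻¹ * h ^ m / 2)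
  obtain ⟨R, hR, hsmall⟩ := exists_two_le_forall_rpow_mul_rpow_le hn (deGiorgiConst_nonneg n hK₂)
    (levelSetConst_nonneg n hK₁) (half_pos hκ0)
    (by positivity : 0 < ((4 : ℝ) ^ ((n : ℝ) / (n - 1)))⁻¹ ^ ((n : ℝ) / (n - 1) - 1)⁻¹)
  refine ⟨R, by linarith, fun F W Ω u G hmin hA hB hC hΩ hub => ?_⟩
  have hvol := (hmin.satisfiesCaccioppoli_neg_one hA hB hC hp hm hlam hh ⟨hκ0, hκ1⟩ hΩ
    hub).volume_superlevel_le_pow (by omega) hp hK₁ hmin.measurable (by linarith) hR (by linarith)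
    (hmin.memW1pLoc.integrableOn_caccioppoliDensity hmin.measurable hp0
      ((Metric.closedBall_subset_ball (by linarith)).trans hΩ))
  have hle := hmin.memW1pLoc.ae_le_of_forall_satisfiesCaccioppoli hn hp hK₂ hmin.isOpen hΩ
    hmin.measurable hmin.measurable_gradient (fun x => by linarith [(hmin.mem_Icc x).2])
    (half_pos hκ0) (by linarith) (by linarith)
    (fun l hl => hmin.satisfiesCaccioppoli_of_mem_Icc hA hB hC hp hm.le hlam hh hκ1.le hκh hΩ hub
      ⟨by linarith [hl.1], by linarith [hl.2]⟩)
    (hsmall _ measureReal_nonneg hvol)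
  filter_upwards [hle] with x hx
  linarith

end Minimizers

section Representatives

variable {n : ℕ} {p : ℝ} {F : 𝔼 n → ℝ → 𝔼 n → ℝ} {W : ℝ → 𝔼 n → ℝ} {Ω : Set (𝔼 n)}
  {u v : 𝔼 n → ℝ} {G H : 𝔼 n → 𝔼 n}

theorem IsWeakGradient.congr_ae (h : IsWeakGradient Ω u G) (huv : u =ᵐ[volume.restrict Ω] v)
    (hGH : G =ᵐ[volume.restrict Ω] H) : IsWeakGradient Ω v H := fun φ hφ hφc hφs => by
  rw [← integral_congr_ae (huv.smul (.refl _ (gradient φ))), h φ hφ hφc hφs,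
    integral_congr_ae ((EventuallyEq.refl _ φ).smul hGH)]

theorem MemW1pLoc.congr_ae (h : MemW1pLoc p Ω u G) (huv : u =ᵐ[volume.restrict Ω] v)
    (hGH : G =ᵐ[volume.restrict Ω] H) : MemW1pLoc p Ω v H where
  memLp K hK hKΩ := (memLp_congr_ae (ae_restrict_of_ae_restrict_of_subset hKΩ huv)).mp
    (h.memLp K hK hKΩ)
  memLp_gradient K hK hKΩ := (memLp_congr_ae (ae_restrict_of_ae_restrict_of_subset hKΩ hGH)).mp
    (h.memLp_gradient K hK hKΩ)
  isWeakGradient := h.isWeakGradient.congr_ae huv hGH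

theorem energy_congr_ae {D : Set (𝔼 n)} (huv : u =ᵐ[volume.restrict D] v)
    (hGH : G =ᵐ[volume.restrict D] H) : energy F W u G D = energy F W v H D :=
  lintegral_congr_ae <| by
    filter_upwards [huv, hGH] with x hx hx'
    rw [hx, hx']

theorem IsMinimizer.exists_isMeasurableMinimizer (h : IsMinimizer p F W Ω u) (hp : 1 ≤ p)
    (hΩ : IsOpen Ω) : ∃ v G, IsMeasurableMinimizer p F W Ω v G ∧ u =ᵐ[volume.restrict Ω] v := by
  obtain ⟨G, ⟨hu, hu1⟩, hmin⟩ := h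
  have hum : AEStronglyMeasurable u (volume.restrict Ω) :=
    (hu.locallyIntegrableOn hp hΩ).aestronglyMeasurable
  have hGm : AEStronglyMeasurable G (volume.restrict Ω) :=
    (hu.locallyIntegrableOn_gradient hp hΩ).aestronglyMeasurable
  have huv : u =ᵐ[volume.restrict Ω] fun x => max (-1) (min 1 (hum.mk u x)) := by
    filter_upwards [hum.ae_eq_mk, hu1] with x hx hx1
    rw [← hx, min_eq_right hx1.2, max_eq_right hx1.1]
  refine ⟨_, hGm.mk G, ⟨hΩ, ?_, hGm.stronglyMeasurable_mk.measurable, fun x => ?_,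
    hu.congr_ae huv hGm.ae_eq_mk, fun D hD hDb hDΩ w H hw hwv => ?_⟩, huv⟩
  · exact measurable_const.max (measurable_const.min hum.stronglyMeasurable_mk.measurable)
  · exact ⟨le_max_left _ _, max_le (by norm_num) (min_le_left _ _)⟩
  · have hsub : D ⊆ Ω := subset_closure.trans hDΩ
    rw [← energy_congr_ae (ae_restrict_of_ae_restrict_of_subset hsub huv)
      (ae_restrict_of_ae_restrict_of_subset hsub hGm.ae_eq_mk)]
    refine hmin D hD hDb hDΩ w H hw ?_
    filter_upwards [ae_restrict_of_ae_restrict_of_subset sdiff_subset huv,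
      ae_restrict_mem (hΩ.measurableSet.diff hD.measurableSet)] with x hx hxD
    rw [hwv x hxD.2, hx]

theorem IsMeasurableMinimizer.locallyIntegrable (h : IsMeasurableMinimizer p F W Ω u G) :
    LocallyIntegrable u :=
  (locallyIntegrable_const (1 : ℝ)).mono h.measurable.aestronglyMeasurable <|
    .of_forall fun x => by simpa using abs_le.mpr (h.mem_Icc x)

end Representatives

section PreciseValue

variable {n : ℕ} {u v : 𝔼 n → ℝ} {x : 𝔼 n} {c : ℝ}

theorem ae_hasPreciseValue (hu : LocallyIntegrable u) : ∀ᵐ x, HasPreciseValue u x (u x) := by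
  filter_upwards [(Besicovitch.vitaliFamily volume).ae_tendsto_average hu] with x hx
  refine (hx.comp (Besicovitch.tendsto_filterAt volume x)).congr' ?_
  filter_upwards [self_mem_nhdsWithin] with r hr
  refine setAverage_congr (Metric.ball_subset_closedBall.eventuallyLE.antisymm ?_).symm
  rw [ae_le_set, Metric.closedBall_sdiff_ball]
  exact Measure.addHaar_sphere_of_ne_zero volume x (ne_of_gt hr)

theorem HasPreciseValue.congr_ae (h : HasPreciseValue u x c) {U : Set (𝔼 n)} (hU : IsOpen U)
    (huv : u =ᵐ[volume.restrict U] v) (hx : x ∈ U) : HasPreciseValue v x c := by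
  obtain ⟨δ, hδ, hδU⟩ := Metric.isOpen_iff.mp hU x hx
  refine Tendsto.congr' ?_ h
  filter_upwards [Ioo_mem_nhdsGT hδ] with r hr
  exact average_congr (ae_restrict_of_ae_restrict_of_subset
    ((Metric.ball_subset_ball hr.2.le).trans hδU) huv)

theorem HasPreciseValue.le_of_ae_le (h : HasPreciseValue u x c) {R b : ℝ} (hR : 0 < R)
    (hu : IntegrableOn u (Metric.ball x R))
    (hb : ∀ᵐ y ∂volume.restrict (Metric.ball x R), u y ≤ b) : c ≤ b := by
  refine le_of_tendsto h ?_
  filter_upwards [Ioo_mem_nhdsGT hR] with r hr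
  have hball : Metric.ball x r ⊆ Metric.ball x R := Metric.ball_subset_ball hr.2.le
  exact (convex_Iic b).set_average_mem isClosed_Iic (Metric.measure_ball_pos volume x hr.1).ne'
    measure_ball_lt_top.ne (ae_restrict_of_ae_restrict_of_subset hball hb) (hu.mono_set hball)

end PreciseValue

theorem lemma2p2_general {n : ℕ} (hn : 2 ≤ n) {p m lam h a : ℝ} (hp : 1 ≤ p) (hm : 0 < m)
    (hlam : 0 < lam) (hh : 0 < h) (ha : -1 < a) :
    ∃ ρ : ℝ, 0 < ρ ∧ ∀ (F : 𝔼 n → ℝ → 𝔼 n → ℝ) (W : ℝ → 𝔼 n → ℝ),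
      AssumptionA p lam F → AssumptionB m lam W → AssumptionC W →
      ∀ (Ω : Set (𝔼 n)) (u : 𝔼 n → ℝ),
        IsOpen Ω → Metric.ball 0 ρ ⊆ Ω → IsMinimizer p F W Ω u → HasPreciseValue u 0 a →
        ∃ x ∈ Metric.ball (0 : 𝔼 n) ρ, ∃ c : ℝ, HasPreciseValue u x c ∧ 1 - h ≤ c := by
  obtain ⟨δ, hδ, hδa⟩ : ∃ δ : ℝ, 0 < δ ∧ -1 + δ < a := ⟨(1 + a) / 2, by linarith, by linarith⟩
  obtain ⟨R, hR, hradius⟩ := exists_radius_forall_ae_le hn hp hm hlam hh hδ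
  refine ⟨3 * R, by linarith, fun F W hA hB hC Ω u hΩ hball hmin hua => ?_⟩
  by_contra! hlt
  obtain ⟨v, G, hv, huv⟩ := hmin.exists_isMeasurableMinimizer hp hΩ
  have hv_le : ∀ᵐ x ∂volume.restrict (Metric.ball 0 (3 * R)), v x ≤ 1 - h := by
    filter_upwards [ae_restrict_of_ae (ae_hasPreciseValue hv.locallyIntegrable),
      ae_restrict_mem measurableSet_ball] with x hx hxR
    exact (hlt x hxR (v x) (hx.congr_ae hΩ huv.symm (hball hxR))).le
  have hva : HasPreciseValue v 0 a :=
    hua.congr_ae hΩ huv (hball (Metric.mem_ball_self (by linarith)))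
  have ha_le : a ≤ -1 + δ := hva.le_of_ae_le hR
    ((hv.locallyIntegrable.integrableOn_isCompact (isCompact_closedBall 0 R)).mono_set
      Metric.ball_subset_closedBall) (hradius F W Ω v G hv hA hB hC hball hv_le)
  exact ha_le.not_gt hδa

theorem lemma2p2 (n : ℕ) (hn : 2 ≤ n) (p m lam : ℝ)
    (hp : 1 < p) (hpn : p < (n : ℝ) / ((n : ℝ) - 1)) (hm : p < m) (hlam : 0 < lam)
    (h : ℝ) (h_pos : 0 < h) (h_lt : h < 1) :
    ∃ ρ : ℝ, 0 < ρ ∧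
      ∀ (F : EuclideanSpace ℝ (Fin n) → ℝ → EuclideanSpace ℝ (Fin n) → ℝ)
        (W : ℝ → EuclideanSpace ℝ (Fin n) → ℝ),
        AssumptionA p lam F → AssumptionB m lam W → AssumptionC W →
        ∀ (Ω : Set (EuclideanSpace ℝ (Fin n))) (u : EuclideanSpace ℝ (Fin n) → ℝ),
          IsOpen Ω → Metric.ball 0 ρ ⊆ Ω → IsMinimizer p F W Ω u → HasPreciseValue u 0 0 →
          ∃ x ∈ Metric.ball (0 : EuclideanSpace ℝ (Fin n)) ρ, ∃ c : ℝ,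
            HasPreciseValue u x c ∧ 1 - h ≤ c := by
  exact lemma2p2_general hn hp.le (by linarith) hlam h_pos (by norm_num)
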